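/- **Theorem (Recurrence of the Jaynes–Cummings–Hubbard control system).** Let $M\ge 2$ and $\mathcal H_M=(L^2(\mathbb R)\otimes\mathbb C^2)^{\otimes M}\cong L^2(\mathbb R^M;(\mathbb C^2)^{\otimes M})$. Let $\omega^P_i,\omega^A_i,\omega^I_i>0$ ($1\le i\le M$), and let $I\subseteq\{(i,j):1\le i<j\le M\}$ be the edge set of a connected graph on $\{1,\dots,M\}$. Let $D\subset\mathcal H_M$ be the span of the vectors $|m_1\rangle\otimes|b_1\rangle\otimes\cdots\otimes|m_M\rangle\otimes|b_M\rangle$, where $|m\rangle$ ($m\in\mathbb N_0$) are the normalized Hermite functions in $L^2(\mathbb R)$ and $|b\rangle$ ($b\in\{0,1\}$) is the canonical basis of $\mathbb C^2$. Let $a_i,a_i^*$ be the annihilation and creation operators $a=(x+\partial_x)/\sqrt2$, $a^*=(x-\partial_x)/\sqrt2$ of the $i$-th oscillator, and let $\sigma^x_i,\sigma^y_i,\sigma^z_i$, $\sigma_i^\pm=(\sigma^x_i\pm \mathrm i\sigma^y_i)/2$ be the Pauli matrices on the $i$-th factor $\mathbb C^2$. On $D$ put $$H_0=\sum_{i=1}^M\big[\omega^P_i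 a_i^*a_i+\omega^A_i\sigma^z_i+\omega^I_i(a_i^*\sigma_i^-+a_i\sigma_i^+)\big],\qquad H_H^I=\sum_{(j,k)\in I}(a_j^*a_k+a_ja_k^*).$$ Let $H$ be the closure of one of the operators $H_0$, $H_0+\sigma^z_i$, $H_0+\sigma^x_i$ ($1\le i\le M$), $H_0+H_H^I$, $H_0+\mathbb 1$ on $D$. Then: 1. $H$ is self-adjoint, and $\mathcal H_M$ has an orthonormal basis that consists of eigenvectors of $H$. 2. For each $i$, the closure $T$ of $H_0+\sigma^x_i$ has compact resolvent: there is a real $\lambda$ for which $\lambda-T$ is a bijection of $\operatorname{dom}T$ onto $\mathcal H_M$ with bounded inverse, and for every such $\lambda$ the operator $(\lambda-T)^{-1}$ is compact. 3. There is exactly one strongly continuous one-parameter unitary group $(e^{\mathrm itH})_{t\in\mathbb R}$ with infinitesimal generator $\mathrm iH$, and it satisfies the recurrence condition: for all $t_-\le 0$, all $\varepsilon>0$ and all $\psi_1,\dots,\psi_f\in\mathcal H_M$ ($f\in\mathbb N$) there is $t_+\ge 0$ with $$\big\|(e^{\mathrm it_-H}-e^{\mathrm it_+H})\psi_l\big\|\le\varepsilon\qquad\text{for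 all } l=1,\dots,f.$$ -/

import Mathlib

noncomputable section

namespace JCH

open MeasureTheory
open scoped SchwartzMap ContDiff LineDeriv

/-! ### The Hilbert space -/

/-- Photon configuration space `ℝ^M`, one oscillator coordinate per cavity. -/
abbrev Conf (M : ℕ) : Type := EuclideanSpace ℝ (Fin M)

/-- The state space `(ℂ²)^{⊗M}` of the `M` atoms, with its canonical orthonormal basis indexed by
`Fin M → Fin 2`. -/
abbrev Atoms (M : ℕ) : Type := EuclideanSpace ℂ (Fin M → Fin 2)

/-- The Hilbert space `(L²(ℝ) ⊗ ℂ²)^{⊗M} = L²(ℝ^M; (ℂ²)^{⊗M})`. -/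
abbrev Hil (M : ℕ) : Type := Lp (Atoms M) 2 (volume : Measure (Conf M))

/-- Schwartz functions with values in the atomic space. All operators below are first given by
their usual formulas on these functions. -/
abbrev Sch (M : ℕ) : Type := 𝓢(Conf M, Atoms M)

/-- The inclusion of Schwartz functions in the Hilbert space. -/
def incl (M : ℕ) : Sch M →ₗ[ℂ] Hil M :=
  (SchwartzMap.toLpCLM ℂ (Atoms M) 2 (volume : Measure (Conf M))).toLinearMap

theorem incl_injective (M : ℕ) : Function.Injective (incl M) :=
  SchwartzMap.injective_toLp 2 (volume : Measure (Conf M))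

/-! ### The number basis -/

/-- The `n`-th normalized Hermite function
`h_n(x) = (n! √π)^{-1/2} He_n(√2 x) e^{-x²/2}`, where `He_n` is the probabilists' Hermite
polynomial; it is the eigenfunction of `a* a` with eigenvalue `n`. -/
def hermiteFunction (n : ℕ) (x : ℝ) : ℝ :=
  (Real.sqrt ((n.factorial : ℝ) * Real.sqrt Real.pi))⁻¹ *
    Polynomial.aeval (Real.sqrt 2 * x) (Polynomial.hermite n) * Real.exp (-(x ^ 2) / 2)

theorem gaussian_decay {M : ℕ} (k n : ℕ) : ∃ C : ℝ, ∀ x : Conf M,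
    ‖x‖ ^ k * ‖iteratedFDeriv ℝ n (fun x : Conf M => Real.exp (-(‖x‖ ^ 2) / 2)) x‖ ≤ C := by
  have hq : Function.HasTemperateGrowth (fun x : Conf M => -(‖x‖ ^ 2) / 2) := by
    have h := (Function.hasTemperateGrowth_norm_sq (H := Conf M)).neg.mul
      (Function.HasTemperateGrowth.const (2⁻¹ : ℝ))
    simpa [div_eq_mul_inv, Pi.mul_def, Pi.neg_def] using h
  obtain ⟨l, C, hC0, hC⟩ := hq.norm_iteratedFDeriv_le_uniform n
  have key : ∀ x : Conf M,
      ‖iteratedFDeriv ℝ n (fun x : Conf M => Real.exp (-(‖x‖ ^ 2) / 2)) x‖ ≤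
        n.factorial * Real.exp (-(‖x‖ ^ 2) / 2) * ((1 + C) * (1 + ‖x‖) ^ l) ^ n := by
    intro x
    refine norm_iteratedFDeriv_comp_le (g := Real.exp) (N := ∞) Real.contDiff_exp hq.1
      (by exact_mod_cast le_top) x (fun i _ => ?_) (fun i hi hin => ?_)
    · rw [norm_iteratedFDeriv_eq_norm_iteratedDeriv, iteratedDeriv_eq_iterate, Real.iter_deriv_exp,
        Real.norm_eq_abs, abs_of_pos (Real.exp_pos _)]
    · have h1 : (1 : ℝ) ≤ (1 + ‖x‖) ^ l := one_le_pow₀ (by linarith [norm_nonneg x])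
      calc _ ≤ C * (1 + ‖x‖) ^ l := hC i hin x
        _ ≤ (1 + C) * (1 + ‖x‖) ^ l := by gcongr; linarith
        _ ≤ _ := le_self_pow₀ (by nlinarith) (by omega)
  have hbdd : ∃ B : ℝ, ∀ r : ℝ, 0 ≤ r → (1 + r) ^ (k + l * n) * Real.exp (-(1 + r)) ≤ B := by
    refine ⟨((k + l * n).factorial : ℝ), fun r hr => ?_⟩
    have := Real.pow_div_factorial_le_exp (1 + r) (by linarith) (k + l * n)
    rw [div_le_iff₀ (by positivity)] at this
    calc _ ≤ (Real.exp (1 + r) * ((k + l * n).factorial : ℝ)) * Real.exp (-(1 + r)) := by gcongr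
      _ = _ := by rw [Real.exp_neg]; field_simp
  obtain ⟨B, hB⟩ := hbdd
  refine ⟨n.factorial * (1 + C) ^ n * Real.exp 2 * B, fun x => ?_⟩
  have hx := norm_nonneg x
  have he : Real.exp (-(‖x‖ ^ 2) / 2) ≤ Real.exp 2 * Real.exp (-(1 + ‖x‖)) := by
    rw [← Real.exp_add]
    exact Real.exp_le_exp.2 (by nlinarith [sq_nonneg (‖x‖ - 1)])
  calc _ ≤ (1 + ‖x‖) ^ k *
        (n.factorial * (Real.exp 2 * Real.exp (-(1 + ‖x‖))) * ((1 + C) * (1 + ‖x‖) ^ l) ^ n) := by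
        gcongr
        · linarith
        · exact (key x).trans (by gcongr)
    _ = n.factorial * (1 + C) ^ n * Real.exp 2 * ((1 + ‖x‖) ^ (k + l * n) * Real.exp (-(1 + ‖x‖))) := by
        rw [mul_pow, ← pow_mul, pow_add]; ring
    _ ≤ _ := by gcongr; exact hB _ hx

/-- The Gaussian `e^{-|x|²/2}` as a Schwartz function. -/
def gaussian (M : ℕ) : 𝓢(Conf M, ℝ) where
  toFun := fun x => Real.exp (-(‖x‖ ^ 2) / 2)
  smooth' := Real.contDiff_exp.comp ((contDiff_norm_sq ℝ).neg.div_const 2)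
  decay' := gaussian_decay

theorem hermite_temperate {M : ℕ} (m : Fin M → ℕ) :
    Function.HasTemperateGrowth (fun x : Conf M => ∏ i,
      ((Real.sqrt (((m i).factorial : ℝ) * Real.sqrt Real.pi))⁻¹ *
        Polynomial.aeval (Real.sqrt 2 * x i) (Polynomial.hermite (m i)))) := by
  have hcoord : ∀ i : Fin M, Function.HasTemperateGrowth (fun x : Conf M => x i) := fun i =>
    (EuclideanSpace.proj (𝕜 := ℝ) i).hasTemperateGrowth
  have hfac : ∀ i : Fin M, Function.HasTemperateGrowth (fun x : Conf M =>
      (Real.sqrt (((m i).factorial : ℝ) * Real.sqrt Real.pi))⁻¹ *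
        Polynomial.aeval (Real.sqrt 2 * x i) (Polynomial.hermite (m i))) := by
    intro i
    refine (Function.HasTemperateGrowth.const _).mul ?_
    simp only [Polynomial.aeval_eq_sum_range]
    refine Function.HasTemperateGrowth.sum fun j _ => ?_
    have h := (Function.HasTemperateGrowth.const (((Polynomial.hermite (m i)).coeff j : ℤ) : ℝ)).mul
      (((Function.HasTemperateGrowth.const (Real.sqrt 2)).mul (hcoord i)).pow j)
    simpa [zsmul_eq_mul, Pi.mul_def, Pi.pow_def] using h
  have : ∀ s : Finset (Fin M), Function.HasTemperateGrowth (fun x : Conf M => ∏ i ∈ s,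
      ((Real.sqrt (((m i).factorial : ℝ) * Real.sqrt Real.pi))⁻¹ *
        Polynomial.aeval (Real.sqrt 2 * x i) (Polynomial.hermite (m i)))) := by
    intro s
    induction s using Finset.induction_on with
    | empty => simp
    | insert a s ha ih => simpa [Finset.prod_insert ha, Pi.mul_def] using (hfac a).mul ih
  exact this Finset.univ

/-- The Schwartz function that realizes `numberState`, see `numberState_apply`. -/
def numberState {M : ℕ} (m : Fin M → ℕ) (b : Fin M → Fin 2) : Sch M :=
  SchwartzMap.postcompCLM (𝕜 := ℝ)
    (ContinuousLinearMap.toSpanSingleton ℝ (EuclideanSpace.single b (1 : ℂ) : Atoms M))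
    (SchwartzMap.smulLeftCLM ℝ (fun x : Conf M => ∏ i,
      ((Real.sqrt (((m i).factorial : ℝ) * Real.sqrt Real.pi))⁻¹ *
        Polynomial.aeval (Real.sqrt 2 * x i) (Polynomial.hermite (m i)))) (gaussian M))

/-- `|m₁⟩ ⊗ |b₁⟩ ⊗ ⋯ ⊗ |m_M⟩ ⊗ |b_M⟩` is the function
`x ↦ h_{m₁}(x₁) ⋯ h_{m_M}(x_M) • e_b`. -/
theorem numberState_apply {M : ℕ} (m : Fin M → ℕ) (b : Fin M → Fin 2) (x : Conf M) :
    numberState m b x =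
      (∏ i, hermiteFunction (m i) (x i)) • (EuclideanSpace.single b (1 : ℂ) : Atoms M) := by
  have hg : gaussian M x = ∏ i, Real.exp (-(x i ^ 2) / 2) := by
    rw [← Real.exp_sum]
    change Real.exp (-(‖x‖ ^ 2) / 2) = _
    rw [EuclideanSpace.real_norm_sq_eq, ← Finset.sum_div, Finset.sum_neg_distrib]
  simp only [numberState, SchwartzMap.postcompCLM_apply,
    SchwartzMap.smulLeftCLM_apply_apply (hermite_temperate m),
    ContinuousLinearMap.toSpanSingleton_apply, hg, hermiteFunction, smul_eq_mul,
    ← Finset.prod_mul_distrib]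

/-- The finite excitation subspace, the span of the number states. -/
def finiteExcitation (M : ℕ) : Submodule ℂ (Sch M) :=
  Submodule.span ℂ (Set.range fun p : (Fin M → ℕ) × (Fin M → Fin 2) => numberState p.1 p.2)

/-! ### The operators -/

/-- Multiplication by the `i`-th coordinate. -/
def position {M : ℕ} (i : Fin M) : Module.End ℂ (Sch M) :=
  (SchwartzMap.smulLeftCLM (Atoms M) (fun x : Conf M => ((x i : ℝ) : ℂ))).toLinearMap

theorem position_apply {M : ℕ} (i : Fin M) (f : Sch M) (x : Conf M) :
    position i f x = ((x i : ℝ) : ℂ) • f x := by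
  have h : Function.HasTemperateGrowth (fun x : Conf M => ((x i : ℝ) : ℂ)) :=
    (Complex.ofRealCLM.comp (EuclideanSpace.proj (𝕜 := ℝ) i)).hasTemperateGrowth
  exact SchwartzMap.smulLeftCLM_apply_apply h f x

/-- The partial derivative in the `i`-th coordinate. -/
def partialDeriv {M : ℕ} (i : Fin M) : Module.End ℂ (Sch M) :=
  (LineDeriv.lineDerivOpCLM ℂ (Sch M) (EuclideanSpace.single i (1 : ℝ) : Conf M)).toLinearMap

theorem partialDeriv_apply {M : ℕ} (i : Fin M) (f : Sch M) (x : Conf M) :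
    partialDeriv i f x = lineDeriv ℝ f x (EuclideanSpace.single i (1 : ℝ)) :=
  SchwartzMap.lineDerivOp_apply _ f x

/-- The annihilation operator `a_i = (x_i + ∂_i) / √2`. -/
def annihilation {M : ℕ} (i : Fin M) : Module.End ℂ (Sch M) :=
  ((Real.sqrt 2 : ℝ) : ℂ)⁻¹ • (position i + partialDeriv i)

/-- The creation operator `a_i^* = (x_i - ∂_i) / √2`. -/
def creation {M : ℕ} (i : Fin M) : Module.End ℂ (Sch M) :=
  ((Real.sqrt 2 : ℝ) : ℂ)⁻¹ • (position i - partialDeriv i)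

/-- The Pauli matrices. The basis vector with index `0` (`σ^z = 1`) is the excited state. -/
def pauliX : Matrix (Fin 2) (Fin 2) ℂ := !![0, 1; 1, 0]

def pauliY : Matrix (Fin 2) (Fin 2) ℂ := !![0, -Complex.I; Complex.I, 0]

def pauliZ : Matrix (Fin 2) (Fin 2) ℂ := !![1, 0; 0, -1]

def pauliPlus : Matrix (Fin 2) (Fin 2) ℂ := (2 : ℂ)⁻¹ • (pauliX + Complex.I • pauliY)

def pauliMinus : Matrix (Fin 2) (Fin 2) ℂ := (2 : ℂ)⁻¹ • (pauliX - Complex.I • pauliY)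

/-- The matrix of `1 ⊗ ⋯ ⊗ A ⊗ ⋯ ⊗ 1` (`A` in the `i`-th factor) on `(ℂ²)^{⊗M}`. -/
def siteMatrix {M : ℕ} (A : Matrix (Fin 2) (Fin 2) ℂ) (i : Fin M) :
    Matrix (Fin M → Fin 2) (Fin M → Fin 2) ℂ :=
  Matrix.of fun s t => ∏ j, (if j = i then A else 1) (s j) (t j)

/-- The operator that acts as the matrix `A` on the `i`-th atom and trivially on the rest. -/
def atomOp {M : ℕ} (A : Matrix (Fin 2) (Fin 2) ℂ) (i : Fin M) : Module.End ℂ (Sch M) :=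
  (SchwartzMap.postcompCLM (𝕜 := ℂ)
    (Matrix.toEuclideanCLM (𝕜 := ℂ) (siteMatrix A i))).toLinearMap

/-- The drift
`H₀ = ∑_i [ω^P_i a_i^* a_i + ω^A_i σ^z_i + ω^I_i (a_i^* σ^-_i + a_i σ^+_i)]`. -/
def drift {M : ℕ} (ωP ωA ωI : Fin M → ℝ) : Module.End ℂ (Sch M) :=
  ∑ i, ((ωP i : ℂ) • (creation i * annihilation i) + (ωA i : ℂ) • atomOp pauliZ i +
    (ωI i : ℂ) • (creation i * atomOp pauliMinus i + annihilation i * atomOp pauliPlus i))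

/-- The hopping term `∑_{(j,k) ∈ I} (a_j^* a_k + a_j a_k^*)`. -/
def hopping {M : ℕ} (I : Finset (Fin M × Fin M)) : Module.End ℂ (Sch M) :=
  ∑ p ∈ I, (creation p.1 * annihilation p.2 + annihilation p.1 * creation p.2)

/-- Labels of the control Hamiltonians `σ^z_i`, `σ^x_i`, `H_H^I` and `1`. -/
inductive Control (M : ℕ) : Type
  | sigmaZ (i : Fin M) : Control M
  | sigmaX (i : Fin M) : Control M
  | hop : Control M
  | one : Control M

def controlOp {M : ℕ} (I : Finset (Fin M × Fin M)) : Control M → Module.End ℂ (Sch M)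
  | .sigmaZ i => atomOp pauliZ i
  | .sigmaX i => atomOp pauliX i
  | .hop => hopping I
  | .one => 1

/-- The operator in the Hilbert space that has the finite excitation subspace as its domain and
acts there as `A`. -/
def onFinite {M : ℕ} (A : Module.End ℂ (Sch M)) : Hil M →ₗ.[ℂ] Hil M where
  domain := (finiteExcitation M).map (incl M)
  toFun := (incl M ∘ₗ A ∘ₗ (finiteExcitation M).subtype) ∘ₗ
    (Submodule.equivMapOfInjective (incl M) (incl_injective M) (finiteExcitation M)).symm.toLinearMap

theorem onFinite_apply {M : ℕ} (A : Module.End ℂ (Sch M)) (f : Sch M)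
    (hf : f ∈ finiteExcitation M) :
    onFinite A ⟨incl M f, Submodule.mem_map_of_mem hf⟩ = incl M (A f) := by
  have h : (Submodule.equivMapOfInjective (incl M) (incl_injective M) (finiteExcitation M)).symm
      ⟨incl M f, Submodule.mem_map_of_mem hf⟩ = ⟨f, hf⟩ := by
    rw [LinearEquiv.symm_apply_eq]
    exact Subtype.ext rfl
  change incl M (A ((Submodule.equivMapOfInjective (incl M) (incl_injective M)
    (finiteExcitation M)).symm ⟨incl M f, Submodule.mem_map_of_mem hf⟩ : Sch M)) = _
  rw [h]

/-- The Hamiltonians of the control system: `H₀` (for `none`) and `H₀ + H_k` (for `some k`), each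
being the closure of the operator given on the finite excitation subspace. -/
def hamiltonian {M : ℕ} (ωP ωA ωI : Fin M → ℝ) (I : Finset (Fin M × Fin M)) :
    Option (Control M) → (Hil M →ₗ.[ℂ] Hil M)
  | none => (onFinite (drift ωP ωA ωI)).closure
  | some k => (onFinite (drift ωP ωA ωI + controlOp I k)).closure

/-! ### Unbounded operators and recurrence -/

section Abstract

variable {E : Type*} [NormedAddCommGroup E] [InnerProductSpace ℂ E]

/-- There is an orthonormal basis of `E` that consists of eigenvectors of `T` with real
eigenvalues. -/
def HasOrthonormalEigenbasis (T : E →ₗ.[ℂ] E) : Prop :=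
  ∃ (e : HilbertBasis ℕ ℂ E) (ev : ℕ → ℝ),
    ∀ n, ∃ h : e n ∈ T.domain, T ⟨e n, h⟩ = (ev n : ℂ) • e n

/-- `R` is the bounded everywhere defined inverse of `r - T`. -/
def IsResolvent (T : E →ₗ.[ℂ] E) (r : ℝ) (R : E →L[ℂ] E) : Prop :=
  (∀ ψ, ∃ h : R ψ ∈ T.domain, (r : ℂ) • R ψ - T ⟨R ψ, h⟩ = ψ) ∧
    ∀ φ : T.domain, R ((r : ℂ) • (φ : E) - T φ) = φ

/-- Some real number is in the resolvent set, and the resolvents at all such numbers are compact. -/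
def HasCompactResolvent (T : E →ₗ.[ℂ] E) : Prop :=
  (∃ r R, IsResolvent T r R) ∧ ∀ r R, IsResolvent T r R → IsCompactOperator R

/-- `U` is the strongly continuous one-parameter unitary group `t ↦ e^{itT}`: the vectors at which
`t ↦ U t ψ` is differentiable at `0` are those in the domain of `T`, and the derivative is
`i T ψ`. -/
structure IsExpGroup (T : E →ₗ.[ℂ] E) (U : ℝ → (E ≃ₗᵢ[ℂ] E)) : Prop where
  map_add : ∀ s t ψ, U (s + t) ψ = U s (U t ψ)
  continuous : ∀ ψ, Continuous fun t => U t ψ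
  generator : ∀ ψ χ,
    HasDerivAt (fun t => U t ψ) χ 0 ↔ ∃ h : ψ ∈ T.domain, χ = Complex.I • T ⟨ψ, h⟩

/-- The recurrence condition for a one-parameter group. -/
def IsRecurrent (U : ℝ → (E ≃ₗᵢ[ℂ] E)) : Prop :=
  ∀ tm : ℝ, tm ≤ 0 → ∀ ε : ℝ, 0 < ε → ∀ (f : ℕ) (ψ : Fin f → E),
    ∃ tp : ℝ, 0 ≤ tp ∧ ∀ l, ‖U tm (ψ l) - U tp (ψ l)‖ ≤ ε

end Abstract

end JCH

end

noncomputable section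

namespace JCH

open MeasureTheory Filter Topology

/-! ### Maximal diagonal operators and closures of symmetric operators. -/

section DiagonalOperators

variable {E : Type*} [NormedAddCommGroup E] [InnerProductSpace ℂ E] {ι : Type*}

/-! Everything reduces to one fact: each closed Hamiltonian is the maximal diagonal operator `diagOp
e ev` of some Hilbert basis `e` indexed by `ℕ` with real eigenvalues `ev`. A symmetric operator
whose graph closure contains a complete orthonormal set of eigenpairs has exactly that diagonal
operator as its closure (`closure_eq_diagOp`), and diagonal operators are self-adjoint.

All Hamiltonians except those with `σ^x` conserve the total number of excitations, photons plus
excited atoms. For each value of this number the number states span a finite-dimensional space,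
these spaces are mutually orthogonal, and together they are total. So diagonalizing one symmetric
matrix per excitation number yields the eigenbasis (`exists_eigenbasis_of_blocks`). Totality is the
completeness of the Hermite functions: a function orthogonal to all of them has vanishing Gaussian
moments, hence a vanishing Fourier transform after multiplication by the Gaussian
(`eq_zero_of_inner_numberState`).

The control `σ^x_i` breaks the conservation law, but it is bounded. The quadratic form of the drift
grows linearly in the excitation number (`exists_re_inner_drift_ge`), so the drift eigenvalues tend
to infinity and its resolvent is compact. A Neumann series carries compactness over to the perturbed
operator (`exists_compact_resolvent_of_perturbation`), and the spectral theorem for the compact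
symmetric resolvent gives the eigenbasis.

In an eigenbasis the group multiplies coefficients by `e^{it ev n}`, and any group with the same
generator must act so on each basis vector. Recurrence is compactness of the torus `Circle^ℕ`: the
orbit of phases has a convergent subsequence, and differences of its times tend to infinity while
all phases tend to 1 (`exists_return_times`). Unitarity upgrades convergence on basis vectors to
strong convergence. -/

theorem hilbertBasis_ext (e : HilbertBasis ι ℂ E) {x y : E}
    (h : ∀ n, inner ℂ (e n) x = inner ℂ (e n) y) : x = y := by
  refine e.repr.injective (lp.ext (funext fun n => ?_))
  simpa only [e.repr_apply_apply] using h n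

theorem inner_hilbertBasis_self (e : HilbertBasis ι ℂ E) (n : ι) : inner ℂ (e n) (e n) = (1 : ℂ) := by
  simp [e.orthonormal.1 n]

/-- The graph of the maximal operator that is diagonal in the basis `e` with eigenvalues `ev`. -/
def diagGraph (e : HilbertBasis ι ℂ E) (ev : ι → ℝ) : Submodule ℂ (E × E) where
  carrier := {p | ∀ n, inner ℂ (e n) p.2 = (ev n : ℂ) * inner ℂ (e n) p.1}
  add_mem' := fun {p q} hp hq n => by
    simp only [Prod.fst_add, Prod.snd_add, inner_add_right, hp n, hq n, mul_add]
  zero_mem' := fun n => by simp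
  smul_mem' := fun c p hp n => by
    simp only [Prod.smul_fst, Prod.smul_snd, inner_smul_right, hp n]; ring

theorem mem_diagGraph {e : HilbertBasis ι ℂ E} {ev : ι → ℝ} {p : E × E} :
    p ∈ diagGraph e ev ↔ ∀ n, inner ℂ (e n) p.2 = (ev n : ℂ) * inner ℂ (e n) p.1 := Iff.rfl

/-- The maximal operator that is diagonal in the basis `e` with eigenvalues `ev`. -/
def diagOp (e : HilbertBasis ι ℂ E) (ev : ι → ℝ) : E →ₗ.[ℂ] E := (diagGraph e ev).toLinearPMap

theorem graph_diagOp (e : HilbertBasis ι ℂ E) (ev : ι → ℝ) :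
    (diagOp e ev).graph = diagGraph e ev := by
  refine Submodule.toLinearPMap_graph_eq _ fun p hp h0 => ?_
  refine hilbertBasis_ext e fun n => ?_
  rw [hp n, h0]
  simp

theorem basis_mem_diagGraph (e : HilbertBasis ι ℂ E) (ev : ι → ℝ) (m : ι) :
    (e m, (ev m : ℂ) • e m) ∈ diagGraph e ev := by
  classical
  intro n
  simp only [inner_smul_right, orthonormal_iff_ite.mp e.orthonormal n m]
  split_ifs with h
  · rw [h]
  · simp

theorem exists_mem_domain_iff (T : E →ₗ.[ℂ] E) (ψ χ : E) :
    (∃ h : ψ ∈ T.domain, T ⟨ψ, h⟩ = χ) ↔ (ψ, χ) ∈ T.graph := by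
  rw [LinearPMap.mem_graph_iff]
  constructor
  · rintro ⟨h, rfl⟩
    exact ⟨⟨ψ, h⟩, rfl, rfl⟩
  · rintro ⟨⟨x, hx⟩, h1, h2⟩
    dsimp at h1 h2
    subst h1
    exact ⟨hx, h2⟩

/-- The basis expansions of `ψ` and `χ` converge jointly, and each partial sum of the pair is a
linear combination of eigenpairs. -/
theorem diagGraph_le_topologicalClosure (e : HilbertBasis ι ℂ E) (ev : ι → ℝ)
    {G : Submodule ℂ (E × E)} (h : ∀ n, (e n, (ev n : ℂ) • e n) ∈ G.topologicalClosure) :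
    diagGraph e ev ≤ G.topologicalClosure := by
  rintro ⟨ψ, χ⟩ hp
  have h1 := e.hasSum_repr ψ
  have h2 := e.hasSum_repr χ
  have h3 := h1.prodMk h2
  refine G.isClosed_topologicalClosure.mem_of_tendsto h3 (Eventually.of_forall fun s => ?_)
  refine Submodule.sum_mem _ fun n _ => ?_
  have : (e.repr ψ n • e n, e.repr χ n • e n) = e.repr ψ n • (e n, (ev n : ℂ) • e n) := by
    have := hp n
    dsimp only at this
    rw [Prod.smul_mk, e.repr_apply_apply, e.repr_apply_apply, this, smul_smul, mul_comm]
  rw [this]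
  exact Submodule.smul_mem _ _ (h n)

/-- A linear relation is symmetric if `⟨χ, ψ'⟩ = ⟨ψ, χ'⟩` for all pairs in it. -/
def IsSymmRel (G : Submodule ℂ (E × E)) : Prop :=
  ∀ p ∈ G, ∀ q ∈ G, inner ℂ p.2 q.1 = (inner ℂ p.1 q.2 : ℂ)

theorem IsSymmRel.topologicalClosure {G : Submodule ℂ (E × E)} (hG : IsSymmRel G) :
    IsSymmRel G.topologicalClosure := by
  have h1 : ∀ p ∈ G, ∀ q ∈ G.topologicalClosure, inner ℂ p.2 q.1 = (inner ℂ p.1 q.2 : ℂ) := by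
    intro p hp q hq
    have : (G.topologicalClosure : Set (E × E)) ⊆
        {q | inner ℂ p.2 q.1 = (inner ℂ p.1 q.2 : ℂ)} := by
      rw [Submodule.topologicalClosure_coe]
      exact closure_minimal (fun q hq => hG p hp q hq)
        (isClosed_eq (by fun_prop) (by fun_prop))
    exact this hq
  intro p hp q hq
  have : (G.topologicalClosure : Set (E × E)) ⊆
      {p | inner ℂ p.2 q.1 = (inner ℂ p.1 q.2 : ℂ)} := by
    rw [Submodule.topologicalClosure_coe]
    exact closure_minimal (fun p hp => h1 p hp q hq)
      (isClosed_eq (by fun_prop) (by fun_prop))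
  exact this hp

/-- Symmetry tested against an eigenpair forces the `n`-th coefficient of the image to be `ev n`
times that of the argument, so the closed graph is at most the diagonal one; the converse inclusion
is density of eigenpair combinations. This replaces a deficiency-index argument. -/
theorem closure_eq_diagOp {T : E →ₗ.[ℂ] E} (hT : IsSymmRel T.graph) (e : HilbertBasis ι ℂ E)
    (ev : ι → ℝ) (h : ∀ n, (e n, (ev n : ℂ) • e n) ∈ T.graph.topologicalClosure) :
    T.closure = diagOp e ev := by
  have hle : T.graph.topologicalClosure ≤ diagGraph e ev := by
    intro p hp n
    have := hT.topologicalClosure _ (h n) _ hp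
    simp only [inner_smul_left, Complex.conj_ofReal] at this
    exact this.symm
  have heq : T.graph.topologicalClosure = (diagOp e ev).graph := by
    rw [graph_diagOp]
    exact le_antisymm hle (diagGraph_le_topologicalClosure e ev h)
  have hcl : T.IsClosable := ⟨_, heq⟩
  exact LinearPMap.eq_of_eq_graph (hcl.graph_closure_eq_closure_graph.symm.trans heq)

theorem dense_domain_diagOp (e : HilbertBasis ι ℂ E) (ev : ι → ℝ) :
    Dense ((diagOp e ev).domain : Set E) := by
  have h := e.dense_span
  rw [← Submodule.dense_iff_topologicalClosure_eq_top] at h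
  refine h.mono (Submodule.span_le.2 ?_)
  rintro _ ⟨n, rfl⟩
  exact LinearPMap.mem_domain_of_mem_graph
    (by rw [graph_diagOp]; exact basis_mem_diagGraph e ev n)

theorem isSymmRel_diagGraph (e : HilbertBasis ι ℂ E) (ev : ι → ℝ) :
    IsSymmRel (diagGraph e ev) := by
  intro p hp q hq
  rw [← e.tsum_inner_mul_inner, ← e.tsum_inner_mul_inner]
  refine tsum_congr fun n => ?_
  rw [hq n, ← inner_conj_symm p.2, ← inner_conj_symm p.1, hp n, map_mul, Complex.conj_ofReal]
  ring

/-- Testing the adjoint relation on the eigenpairs alone already gives the coefficient condition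
that defines `diagGraph`; Parseval gives the converse. -/
theorem isSelfAdjoint_diagOp [CompleteSpace E] (e : HilbertBasis ι ℂ E) (ev : ι → ℝ) :
    IsSelfAdjoint (diagOp e ev) := by
  rw [LinearPMap.isSelfAdjoint_def]
  refine LinearPMap.eq_of_eq_graph ?_
  rw [LinearPMap.adjoint_graph_eq_graph_adjoint (dense_domain_diagOp e ev), graph_diagOp]
  ext p
  rw [Submodule.mem_adjoint_iff]
  constructor
  · intro h n
    have := h _ _ (basis_mem_diagGraph e ev n)
    rw [inner_smul_left, Complex.conj_ofReal, sub_eq_zero] at this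
    exact this.symm
  · intro hp a b hab
    rw [sub_eq_zero]
    exact isSymmRel_diagGraph e ev (a, b) hab p hp

theorem hasOrthonormalEigenbasis_diagOp (e : HilbertBasis ℕ ℂ E) (ev : ℕ → ℝ) :
    HasOrthonormalEigenbasis (diagOp e ev) :=
  ⟨e, ev, fun n => (exists_mem_domain_iff _ _ _).2
    (by rw [graph_diagOp]; exact basis_mem_diagGraph e ev n)⟩

end DiagonalOperators

/-! ### The unitary group of a diagonal operator, its uniqueness and its recurrence. -/

section UnitaryGroup

variable {E : Type*} [NormedAddCommGroup E] [InnerProductSpace ℂ E] {ι : Type*}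

/-- An `ε/3` argument: isometries are uniformly bounded, so convergence on a dense span suffices. It
serves strong continuity, uniqueness and recurrence alike. -/
theorem tendsto_isometryEquiv_of_basis {κ : Type*} {L : Filter κ} (e : HilbertBasis ι ℂ E)
    (V : κ → (E ≃ₗᵢ[ℂ] E)) (W : E ≃ₗᵢ[ℂ] E)
    (h : ∀ n, Tendsto (fun k => V k (e n)) L (𝓝 (W (e n)))) (ψ : E) :
    Tendsto (fun k => V k ψ) L (𝓝 (W ψ)) := by
  have hspan : ∀ y ∈ Submodule.span ℂ (Set.range e), Tendsto (fun k => V k y) L (𝓝 (W y)) := by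
    intro y hy
    induction hy using Submodule.span_induction with
    | mem x hx => obtain ⟨n, rfl⟩ := hx; exact h n
    | zero => simpa using tendsto_const_nhds
    | add x y _ _ hx hy => simpa using hx.add hy
    | smul c x _ hx => simpa using hx.const_smul c
  have hd := e.dense_span
  rw [← Submodule.dense_iff_topologicalClosure_eq_top] at hd
  rw [Metric.tendsto_nhds]
  intro ε hε
  obtain ⟨y, hy, hyd⟩ := hd.exists_dist_lt ψ (ε := ε / 3) (by positivity)
  filter_upwards [Metric.tendsto_nhds.1 (hspan y hy) (ε / 3) (by positivity)] with k hk
  have h1 : dist (V k ψ) (V k y) = dist ψ y := (V k).dist_map _ _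
  have h2 : dist (W y) (W ψ) = dist y ψ := W.dist_map _ _
  have h3 := dist_triangle4 (V k ψ) (V k y) (W y) (W ψ)
  rw [h1, h2, dist_comm y ψ] at h3
  linarith

/-- The unit complex number `e^{itv}`. -/
def phase (v t : ℝ) : ℂ := Complex.exp (Complex.I * (t * v : ℝ))

theorem norm_phase (v t : ℝ) : ‖phase v t‖ = 1 := by
  rw [phase, mul_comm]; exact Complex.norm_exp_ofReal_mul_I _

theorem phase_add (v s t : ℝ) : phase v (s + t) = phase v s * phase v t := by
  rw [phase, phase, phase, ← Complex.exp_add]; congr 1; push_cast; ring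

theorem phase_zero (v : ℝ) : phase v 0 = 1 := by simp [phase]

theorem hasDerivAt_phase (v t : ℝ) :
    HasDerivAt (phase v) (Complex.I * v * phase v t) t := by
  have h : HasDerivAt (fun t : ℝ => Complex.I * (t * v : ℝ)) (Complex.I * v) t := by
    have := ((hasDerivAt_id t).mul_const v).ofReal_comp.const_mul Complex.I
    simpa using this
  have := h.cexp
  rw [mul_comm] at this
  exact this

theorem continuous_phase (v : ℝ) : Continuous (phase v) :=
  continuous_iff_continuousAt.2 fun t => (hasDerivAt_phase v t).continuousAt

theorem conj_phase_mul (v t : ℝ) : (starRingEnd ℂ) (phase v t) * phase v t = 1 := by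
  rw [mul_comm, Complex.mul_conj, Complex.normSq_eq_norm_sq, norm_phase]; simp

/-- Rotating the basis by phases gives another Hilbert basis, so the time evolution can be defined
as a change of basis and its unitarity comes for free. -/
theorem orthonormal_phase_smul (e : HilbertBasis ι ℂ E) (ev : ι → ℝ) (t : ℝ) :
    Orthonormal ℂ fun n => phase (ev n) t • e n :=
  ⟨fun n => by rw [norm_smul, norm_phase, e.orthonormal.1 n, one_mul],
    fun m n hmn => by simp [inner_smul_left, inner_smul_right, e.orthonormal.2 hmn]⟩

theorem orthogonal_span_phase_smul (e : HilbertBasis ι ℂ E) (ev : ι → ℝ) (t : ℝ) :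
    (Submodule.span ℂ (Set.range fun n => phase (ev n) t • e n))ᗮ = ⊥ := by
  rw [Submodule.eq_bot_iff]
  intro x hx
  refine hilbertBasis_ext e fun n => ?_
  have := (Submodule.mem_orthogonal _ _).1 hx _ (Submodule.subset_span ⟨n, rfl⟩)
  rw [inner_smul_left, mul_eq_zero] at this
  rcases this with h | h
  · have h1 := conj_phase_mul (ev n) t
    rw [h] at h1
    simp at h1
  · rw [h, inner_zero_right]

variable [CompleteSpace E]

/-- The basis `e` with its vectors multiplied by the phases `e^{it ev}`. -/
def phaseBasis (e : HilbertBasis ι ℂ E) (ev : ι → ℝ) (t : ℝ) : HilbertBasis ι ℂ E :=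
  HilbertBasis.mkOfOrthogonalEqBot (orthonormal_phase_smul e ev t)
    (orthogonal_span_phase_smul e ev t)

/-- The unitary group generated by `i • diagOp e ev`. -/
def expGroup (e : HilbertBasis ι ℂ E) (ev : ι → ℝ) (t : ℝ) : E ≃ₗᵢ[ℂ] E :=
  e.repr.trans (phaseBasis e ev t).repr.symm

theorem inner_expGroup (e : HilbertBasis ι ℂ E) (ev : ι → ℝ) (t : ℝ) (n : ι) (ψ : E) :
    inner ℂ (e n) (expGroup e ev t ψ) = phase (ev n) t * inner ℂ (e n) ψ := by
  have h1 : inner ℂ (phaseBasis e ev t n) (expGroup e ev t ψ) = inner ℂ (e n) ψ := by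
    rw [← HilbertBasis.repr_apply_apply, ← e.repr_apply_apply]
    simp [expGroup]
  have h2 : phaseBasis e ev t n = phase (ev n) t • e n := by
    rw [phaseBasis, HilbertBasis.coe_mkOfOrthogonalEqBot]
  rw [h2, inner_smul_left] at h1
  rw [← h1, ← mul_assoc, mul_comm (phase _ _), conj_phase_mul, one_mul]

theorem expGroup_basis (e : HilbertBasis ι ℂ E) (ev : ι → ℝ) (t : ℝ) (m : ι) :
    expGroup e ev t (e m) = phase (ev m) t • e m := by
  classical
  refine hilbertBasis_ext e fun n => ?_
  rw [inner_expGroup, inner_smul_right, orthonormal_iff_ite.mp e.orthonormal n m]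
  split_ifs with h
  · rw [h]
  · simp

theorem continuous_expGroup (e : HilbertBasis ι ℂ E) (ev : ι → ℝ) (ψ : E) :
    Continuous fun t => expGroup e ev t ψ := by
  refine continuous_iff_continuousAt.2 fun t => ?_
  refine tendsto_isometryEquiv_of_basis e (expGroup e ev) (expGroup e ev t) (fun n => ?_) ψ
  simp only [expGroup_basis]
  exact ((continuous_phase (ev n)).smul continuous_const).continuousAt

/-- The hypothesis says `χ = i T ψ` in coordinates. The integrated form of the Schrödinger equation
can be checked coefficient by coefficient; differentiating it then needs only strong continuity. -/
theorem expGroup_eq_add_integral (e : HilbertBasis ι ℂ E) (ev : ι → ℝ) {ψ χ : E}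
    (h : ∀ n, inner ℂ (e n) χ = Complex.I * ev n * inner ℂ (e n) ψ) (t : ℝ) :
    expGroup e ev t ψ = ψ + ∫ s in (0 : ℝ)..t, expGroup e ev s χ := by
  refine hilbertBasis_ext e fun n => ?_
  have hint : inner ℂ (e n) (∫ s in (0 : ℝ)..t, expGroup e ev s χ) =
      ∫ s in (0 : ℝ)..t, inner ℂ (e n) (expGroup e ev s χ) :=
    ((innerSL ℂ (e n)).intervalIntegral_comp_comm
      ((continuous_expGroup e ev χ).intervalIntegrable 0 t)).symm
  rw [inner_add_right, hint, inner_expGroup]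
  simp only [inner_expGroup]
  have h2 : ∀ s ∈ Set.uIcc 0 t, HasDerivAt (fun s => phase (ev n) s * inner ℂ (e n) ψ)
      (phase (ev n) s * inner ℂ (e n) χ) s := fun s _ => by
    refine ((hasDerivAt_phase (ev n) s).mul_const (inner ℂ (e n) ψ)).congr_deriv ?_
    rw [h n]
    ring
  rw [intervalIntegral.integral_eq_sub_of_hasDerivAt h2
    (((continuous_phase _).mul continuous_const).intervalIntegrable _ _), phase_zero]
  ring

/-- If the orbit is differentiable, applying the coefficient functionals identifies the derivative,
and this places `ψ` in the maximal domain. Conversely, the integral formula is differentiated by the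
fundamental theorem of calculus. -/
theorem isExpGroup_expGroup (e : HilbertBasis ι ℂ E) (ev : ι → ℝ) :
    IsExpGroup (diagOp e ev) (expGroup e ev) where
  map_add s t ψ := hilbertBasis_ext e fun n => by
    rw [inner_expGroup, inner_expGroup, inner_expGroup, phase_add, mul_assoc]
  continuous := continuous_expGroup e ev
  generator ψ χ := by
    have key : (∃ h : ψ ∈ (diagOp e ev).domain, χ = Complex.I • diagOp e ev ⟨ψ, h⟩) ↔
        ∀ n, inner ℂ (e n) χ = Complex.I * ev n * inner ℂ (e n) ψ := by
      have : (∃ h : ψ ∈ (diagOp e ev).domain, χ = Complex.I • diagOp e ev ⟨ψ, h⟩) ↔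
          ∃ h : ψ ∈ (diagOp e ev).domain, diagOp e ev ⟨ψ, h⟩ = -Complex.I • χ := by
        refine exists_congr fun h => ⟨fun h => ?_, fun h => ?_⟩
        · rw [h, smul_smul]; simp
        · rw [h, smul_smul]; simp
      rw [this, exists_mem_domain_iff, graph_diagOp, mem_diagGraph]
      refine forall_congr' fun n => ?_
      simp only [inner_smul_right]
      constructor
      · intro h
        rw [mul_assoc, ← h, ← mul_assoc]; simp
      · intro h
        rw [h, ← mul_assoc, ← mul_assoc]; simp
    rw [key]
    constructor
    · intro hd n
      have h1 := ((innerSL ℂ (e n)).hasFDerivAt (x := expGroup e ev 0 ψ)).restrictScalars ℝ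
        |>.comp_hasDerivAt (0 : ℝ) hd
      have h2 := (hasDerivAt_phase (ev n) 0).mul_const (inner ℂ (e n) ψ)
      have h3 : (innerSL ℂ (e n)) ∘ (fun t => expGroup e ev t ψ) =
          fun t => phase (ev n) t * inner ℂ (e n) ψ := by
        funext t
        exact inner_expGroup e ev t n ψ
      rw [show ((fun x => (innerSL ℂ (e n)) x) ∘ fun t => expGroup e ev t ψ) = _ from h3] at h1
      have := h1.unique h2
      rw [phase_zero, mul_one] at this
      exact this
    · intro h
      have h0 : expGroup e ev 0 χ = χ := hilbertBasis_ext e fun n => by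
        rw [inner_expGroup, phase_zero, one_mul]
      have h1 : HasDerivAt (fun t => ψ + ∫ s in (0 : ℝ)..t, expGroup e ev s χ)
          (expGroup e ev 0 χ) 0 :=
        ((continuous_expGroup e ev χ).integral_hasStrictDerivAt 0 0).hasDerivAt.const_add ψ
      rw [h0] at h1
      refine h1.congr_of_eventuallyEq (Eventually.of_forall fun t => ?_)
      exact expGroup_eq_add_integral e ev h t

/-- Only the orbits of the eigenvectors matter: `e^{-it ev n} U t (e n)` has zero derivative, hence
is constant. -/
theorem IsExpGroup.eq_expGroup {e : HilbertBasis ι ℂ E} {ev : ι → ℝ} {U : ℝ → (E ≃ₗᵢ[ℂ] E)}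
    (hU : IsExpGroup (diagOp e ev) U) : U = expGroup e ev := by
  have hbasis : ∀ t n, U t (e n) = phase (ev n) t • e n := by
    intro t n
    have hd0 : HasDerivAt (fun t => U t (e n)) (Complex.I • ((ev n : ℂ) • e n)) 0 := by
      rw [hU.generator]
      obtain ⟨h, hh⟩ := (exists_mem_domain_iff (diagOp e ev) _ _).2
        (by rw [graph_diagOp]; exact basis_mem_diagGraph e ev n)
      exact ⟨h, by rw [hh]⟩
    -- The group law `U t = U s ∘ U (t - s)` transports the derivative at 0 to every time `s`.
    have hd : ∀ s, HasDerivAt (fun t => U t (e n)) (U s (Complex.I • ((ev n : ℂ) • e n))) s := by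
      intro s
      have h1 : HasDerivAt (fun t => U (t - s) (e n)) (Complex.I • ((ev n : ℂ) • e n)) s := by
        rw [← sub_self s] at hd0
        exact hd0.comp_sub_const s s
      let A : E →L[ℝ] E := ((U s).toContinuousLinearEquiv : E →L[ℂ] E).restrictScalars ℝ
      have h2 := A.hasFDerivAt.comp_hasDerivAt s h1
      refine h2.congr_of_eventuallyEq (Eventually.of_forall fun t => ?_)
      change U t (e n) = U s (U (t - s) (e n))
      rw [← hU.map_add, add_sub_cancel]
    have hg : ∀ s, HasDerivAt (fun t => phase (ev n) (-t) • U t (e n)) 0 s := by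
      intro s
      have h1 : HasDerivAt (fun t => phase (ev n) (-t))
          (-(Complex.I * ev n * phase (ev n) (-s))) s := by
        have := (hasDerivAt_phase (ev n) (-s)).scomp s (hasDerivAt_neg s)
        simpa using! this
      refine (h1.smul (hd s)).congr_deriv ?_
      rw [map_smul, map_smul, smul_smul, smul_smul, ← add_smul]
      convert zero_smul ℂ _ using 2
      ring
    have hc := is_const_of_deriv_eq_zero (fun s => (hg s).differentiableAt)
      (fun s => (hg s).deriv) t 0
    have h0 : U 0 (e n) = e n := (U 0).injective (by
      rw [← hU.map_add, add_zero])
    simp only [neg_zero, phase_zero, one_smul, h0] at hc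
    have h1 := congrArg (phase (ev n) t • ·) hc
    simpa only [smul_smul, ← phase_add, add_neg_cancel, phase_zero, one_smul] using h1
  funext t
  refine LinearIsometryEquiv.ext fun ψ => ?_
  have := tendsto_isometryEquiv_of_basis e (fun _ : ℕ => U t) (expGroup e ev t) (L := atTop)
    (fun n => by rw [hbasis, expGroup_basis]; exact tendsto_const_nhds) ψ
  exact tendsto_nhds_unique tendsto_const_nhds this

theorem exists_return_times (ev : ℕ → ℝ) : ∃ s : ℕ → ℝ, Tendsto s atTop atTop ∧
    ∀ n, Tendsto (fun k => phase (ev n) (s k)) atTop (𝓝 1) := by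
  obtain ⟨z, φ, hφ, hz⟩ := CompactSpace.tendsto_subseq (fun k : ℕ => fun n : ℕ =>
    Circle.exp (k * ev n))
  -- Both phase sequences along `φ (2k)` and `φ k` have the same limit, so their quotient tends to
  -- 1; strict monotonicity of `φ` makes the time difference at least `k`.
  refine ⟨fun k => (φ (2 * k) : ℝ) - φ k, ?_, fun n => ?_⟩
  · refine tendsto_atTop_mono (fun k => ?_) tendsto_natCast_atTop_atTop
    have h1 : φ k + k ≤ φ (2 * k) := by
      have := hφ.add_le_nat k k
      rw [two_mul]; omega
    have : (φ k : ℝ) + k ≤ φ (2 * k) := by exact_mod_cast h1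
    linarith
  · rw [tendsto_pi_nhds] at hz
    have h1 := hz n
    have h2 : Tendsto (fun k : ℕ => 2 * k) atTop atTop :=
      tendsto_id.const_mul_atTop' (by norm_num)
    have h3 := (h1.comp h2).div' h1
    rw [div_self'] at h3
    have h4 := (continuous_subtype_val.tendsto (1 : Circle)).comp h3
    rw [Circle.coe_one] at h4
    refine h4.congr fun k => ?_
    simp only [Function.comp]
    rw [← Circle.exp_sub, Circle.coe_exp, phase]
    congr 1
    push_cast
    ring

theorem isRecurrent_expGroup (e : HilbertBasis ℕ ℂ E) (ev : ℕ → ℝ) :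
    IsRecurrent (expGroup e ev) := by
  intro tm _ ε hε f ψ
  obtain ⟨s, hs, hph⟩ := exists_return_times ev
  have h1 : ∀ l, Tendsto (fun k => expGroup e ev (tm + s k) (ψ l)) atTop
      (𝓝 (expGroup e ev tm (ψ l))) := fun l => by
    refine tendsto_isometryEquiv_of_basis e (fun k => expGroup e ev (tm + s k)) _ (fun n => ?_) _
    simp only [expGroup_basis, phase_add]
    simpa using ((hph n).const_mul (phase (ev n) tm)).smul_const (e n)
  have h2 : ∀ᶠ k in atTop, ∀ l, dist (expGroup e ev (tm + s k) (ψ l))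
      (expGroup e ev tm (ψ l)) < ε :=
    eventually_all.2 fun l => Metric.tendsto_nhds.1 (h1 l) ε hε
  obtain ⟨k, hk, hk'⟩ := (h2.and (hs.eventually_ge_atTop (-tm))).exists
  refine ⟨tm + s k, by linarith, fun l => ?_⟩
  rw [← dist_eq_norm, dist_comm]
  exact (hk l).le

theorem existsUnique_isExpGroup_diagOp (e : HilbertBasis ℕ ℂ E) (ev : ℕ → ℝ) :
    (∃! U, IsExpGroup (diagOp e ev) U) ∧ ∀ U, IsExpGroup (diagOp e ev) U → IsRecurrent U :=
  ⟨⟨expGroup e ev, isExpGroup_expGroup e ev, fun _ hU => hU.eq_expGroup⟩,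
    fun _ hU => hU.eq_expGroup ▸ isRecurrent_expGroup e ev⟩

end UnitaryGroup

end JCH

namespace JCH

open MeasureTheory Filter Topology

/-! ### Eigenbases from orthogonal finite-dimensional blocks. -/

section Eigenbases

variable {E : Type*} [NormedAddCommGroup E] [InnerProductSpace ℂ E] {ι κ : Type*}

/-- If `(0, y)` lies in the closed graph, symmetry makes `y` orthogonal to the dense domain. -/
theorem isClosable_of_isSymmRel {T : E →ₗ.[ℂ] E} (hT : IsSymmRel T.graph)
    (hd : Dense (T.domain : Set E)) : T.IsClosable := by
  refine ⟨T.graph.topologicalClosure.toLinearPMap, (Submodule.toLinearPMap_graph_eq _ ?_).symm⟩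
  intro p hp h0
  refine hd.eq_zero_of_inner_left ℂ fun x hx => ?_
  have hx' : (x, T ⟨x, hx⟩) ∈ T.graph.topologicalClosure :=
    T.graph.le_topologicalClosure (T.mem_graph ⟨x, hx⟩)
  have := hT.topologicalClosure p hp _ hx'
  rw [h0, inner_zero_left] at this
  exact this

/-- On each block `T` is a symmetric endomorphism of a finite-dimensional space, so the block
eigenbases glue to a basis of `E`. The index keeps the block, which later ties eigenvalues to
excitation numbers. -/
theorem exists_eigenbasis_of_blocks [CompleteSpace E] {T : E →ₗ.[ℂ] E} (hT : IsSymmRel T.graph)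
    (K : κ → Submodule ℂ E) (hfin : ∀ k, FiniteDimensional ℂ (K k))
    (hort : ∀ j k, j ≠ k → ∀ x ∈ K j, ∀ y ∈ K k, inner ℂ x y = (0 : ℂ))
    (hdense : (⨆ k, K k)ᗮ = ⊥) (hK : ∀ k, ∀ x ∈ K k, ∃ y ∈ K k, (x, y) ∈ T.graph) :
    ∃ (e : HilbertBasis (Σ k, Fin (Module.finrank ℂ (K k))) ℂ E)
      (ev : (Σ k, Fin (Module.finrank ℂ (K k))) → ℝ),
      ∀ n, e n ∈ K n.1 ∧ (e n, (ev n : ℂ) • e n) ∈ T.graph := by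
  choose A hAK hAT using hK
  have hA1 : ∀ k x y hx hy hxy, A k (x + y) hxy = A k x hx + A k y hy := fun k x y hx hy hxy =>
    T.mem_graph_snd_inj (hAT k _ hxy) (T.graph.add_mem (hAT k x hx) (hAT k y hy)) rfl
  have hA2 : ∀ k (c : ℂ) x hx hcx, A k (c • x) hcx = c • A k x hx := fun k c x hx hcx =>
    T.mem_graph_snd_inj (hAT k _ hcx) (T.graph.smul_mem c (hAT k x hx)) rfl
  let F : ∀ k, K k →ₗ[ℂ] K k := fun k =>
    { toFun := fun x => ⟨A k x x.2, hAK k x x.2⟩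
      map_add' := fun x y => Subtype.ext (hA1 k x y x.2 y.2 (x + y).2)
      map_smul' := fun c x => Subtype.ext (hA2 k c x x.2 (c • x).2) }
  have hF : ∀ k, (F k).IsSymmetric := fun k x y =>
    hT _ (hAT k x x.2) _ (hAT k y y.2)
  have hO : OrthogonalFamily ℂ (fun k => K k) fun k => (K k).subtypeₗᵢ :=
    fun j k hjk x y => hort j k hjk x x.2 y y.2
  let b := fun k => (hF k).eigenvectorBasis (n := Module.finrank ℂ (K k)) rfl
  have hon := hO.orthonormal_sigma_orthonormal fun k => (b k).orthonormal
  have hspan : (Submodule.span ℂ (Set.range fun a : Σ k, Fin (Module.finrank ℂ (K k)) =>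
      (K a.1).subtypeₗᵢ (b a.1 a.2)))ᗮ = ⊥ := by
    rw [eq_bot_iff, ← hdense]
    refine Submodule.orthogonal_le (iSup_le fun k => ?_)
    have h1 : K k = (Submodule.span ℂ (Set.range (b k))).map (K k).subtype := by
      have := (b k).toBasis.span_eq
      rw [OrthonormalBasis.coe_toBasis] at this
      rw [this, Submodule.map_subtype_top]
    rw [h1, Submodule.map_span, Submodule.span_le]
    rintro _ ⟨_, ⟨i, rfl⟩, rfl⟩
    exact Submodule.subset_span ⟨⟨k, i⟩, rfl⟩
  refine ⟨HilbertBasis.mkOfOrthogonalEqBot hon hspan,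
    fun a => (hF a.1).eigenvalues rfl a.2, fun a => ?_⟩
  rw [HilbertBasis.coe_mkOfOrthogonalEqBot]
  refine ⟨(b a.1 a.2).2, ?_⟩
  have h1 := hAT a.1 (b a.1 a.2) (b a.1 a.2).2
  have h2 := congrArg Subtype.val ((hF a.1).apply_eigenvectorBasis rfl a.2)
  change A a.1 (b a.1 a.2) (b a.1 a.2).2 = _ at h2
  rw [h2] at h1
  exact h1

/-- Distinct basis vectors are at distance `√2`, so separability leaves room for only countably many
of the disjoint balls. -/
theorem nonempty_equiv_nat [TopologicalSpace.SeparableSpace E] (hE : ¬ FiniteDimensional ℂ E)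
    (e : HilbertBasis ι ℂ E) : Nonempty (ι ≃ ℕ) := by
  classical
  have hc : Countable ι := by
    rw [← Set.countable_univ_iff]
    refine Set.PairwiseDisjoint.countable_of_isOpen (s := fun i => Metric.ball (e i) (1 / 2)) ?_
      (fun i _ => Metric.isOpen_ball) (fun i _ => ⟨e i, Metric.mem_ball_self (by norm_num)⟩)
    intro i _ j _ hij
    refine Metric.ball_disjoint_ball ?_
    have h1 : ‖e i - e j‖ ^ 2 = 2 := by
      rw [@norm_sub_sq ℂ, e.orthonormal.2 hij, e.orthonormal.1, e.orthonormal.1]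
      simp; norm_num
    rw [dist_eq_norm]
    nlinarith [norm_nonneg (e i - e j)]
  have hi : Infinite ι := by
    by_contra hfin
    rw [not_infinite_iff_finite] at hfin
    have h1 : FiniteDimensional ℂ (Submodule.span ℂ (Set.range e)) :=
      FiniteDimensional.span_of_finite ℂ (Set.finite_range e)
    have h2 := e.dense_span
    rw [(Submodule.closed_of_finiteDimensional _).submodule_topologicalClosure_eq] at h2
    rw [h2] at h1
    exact hE (Module.finite_def.2 ((Module.Finite.iff_fg (N := (⊤ : Submodule ℂ E))).1 h1))
  obtain ⟨d⟩ := nonempty_denumerable ι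
  exact ⟨Denumerable.eqv ι⟩

theorem exists_closure_eq_diagOp [CompleteSpace E] [TopologicalSpace.SeparableSpace E]
    (hE : ¬ FiniteDimensional ℂ E) {T : E →ₗ.[ℂ] E} (hT : IsSymmRel T.graph)
    (e : HilbertBasis ι ℂ E) (ev : ι → ℝ)
    (h : ∀ n, (e n, (ev n : ℂ) • e n) ∈ T.graph.topologicalClosure) :
    ∃ (e' : HilbertBasis ℕ ℂ E) (ev' : ℕ → ℝ), T.closure = diagOp e' ev' := by
  obtain ⟨f⟩ := nonempty_equiv_nat hE e
  have hr : Set.range (fun n => e (f.symm n)) = Set.range e := f.symm.surjective.range_comp e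
  let e' : HilbertBasis ℕ ℂ E := HilbertBasis.mk (v := fun n => e (f.symm n))
    (e.orthonormal.comp _ f.symm.injective) (by rw [hr, e.dense_span])
  refine ⟨e', fun n => ev (f.symm n), closure_eq_diagOp hT _ _ fun n => ?_⟩
  have h1 : e' n = e (f.symm n) := by
    rw [HilbertBasis.coe_mk]
  rw [h1]
  exact h _

end Eigenbases

/-! ### Compact resolvents and bounded perturbations. -/

section Resolvents

variable {E : Type*} [NormedAddCommGroup E] [InnerProductSpace ℂ E]

/-- The hypothesis provides a right inverse of `r - T`. Symmetry makes it a left inverse as well: a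
vector in the kernel of `r - T` is orthogonal to its range, which is everything. -/
theorem isResolvent_closure {T : E →ₗ.[ℂ] E} (hT : IsSymmRel T.graph) (hc : T.IsClosable)
    {r : ℝ} {R : E →L[ℂ] E}
    (hR : ∀ u, (R u, (r : ℂ) • R u - u) ∈ T.graph.topologicalClosure) :
    IsResolvent T.closure r R := by
  have hs := hT.topologicalClosure
  have hg := hc.graph_closure_eq_closure_graph
  constructor
  · intro ψ
    have := hR ψ
    rw [hg, ← exists_mem_domain_iff] at this
    obtain ⟨h, hh⟩ := this
    exact ⟨h, by rw [hh]; abel⟩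
  · intro φ
    set u := (r : ℂ) • (φ : E) - T.closure φ with hu
    have h1 := hR u
    have h2 : ((φ : E), T.closure φ) ∈ T.graph.topologicalClosure := by
      rw [hg]; exact T.closure.mem_graph φ
    have h3 := T.graph.topologicalClosure.sub_mem h1 h2
    have h4 : (r : ℂ) • R u - u - T.closure φ = (r : ℂ) • (R u - φ) := by
      rw [hu]; simp only [smul_sub]; abel
    simp only [Prod.mk_sub_mk, h4] at h3
    -- With `w = R u - φ`, the closed graph contains `(w, r w)` and `(R w, r R w - w)`; symmetry of
    -- this pair leaves `⟨w, w⟩ = 0`.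
    have h5 := hs _ (hR (R u - φ)) _ h3
    simp only [inner_sub_left, inner_smul_left, inner_smul_right, Complex.conj_ofReal,
      sub_eq_self] at h5
    exact sub_eq_zero.1 ((inner_self_eq_zero (𝕜 := ℂ)).1 (by rw [inner_sub_left]; exact h5))

/-- The resolvent identity `S = R (1 + (r - s) S)` exhibits `S` as a compact operator after a
bounded one. -/
theorem isCompactOperator_of_isResolvent {T : E →ₗ.[ℂ] E} {r s : ℝ} {R S : E →L[ℂ] E}
    (hR : IsResolvent T r R) (hS : IsResolvent T s S) (hc : IsCompactOperator R) :
    IsCompactOperator S := by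
  have : (S : E → E) = R ∘ (ContinuousLinearMap.id ℂ E + ((r : ℂ) - s) • S : E →L[ℂ] E) := by
    funext ψ
    obtain ⟨h, hh⟩ := hS.1 ψ
    have h1 := hR.2 ⟨S ψ, h⟩
    generalize T ⟨S ψ, h⟩ = y at hh h1
    refine h1.symm.trans ?_
    simp only [Function.comp, add_apply, ContinuousLinearMap.id_apply,
      smul_apply]
    congr 1
    rw [sub_smul]
    nth_rewrite 2 [← hh]
    abel
  rw [this]
  exact hc.comp_clm _

/-- The blocks are the eigenspaces of the compact symmetric operator `R`: finite-dimensional for `μ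
≠ 0`, trivial for `μ = 0` by injectivity. Indexing by all complex `μ` is harmless, since empty
eigenspaces contribute no basis vectors. -/
theorem exists_eigenbasis_of_compact [CompleteSpace E] {T : E →ₗ.[ℂ] E} (hT : IsSymmRel T.graph)
    (hc : T.IsClosable) {r : ℝ} {R : E →L[ℂ] E} (hRc : IsCompactOperator R)
    (hinj : Function.Injective R)
    (hR : ∀ u, (R u, (r : ℂ) • R u - u) ∈ T.graph.topologicalClosure) :
    ∃ (ι : Type) (e : HilbertBasis ι ℂ E) (ev : ι → ℝ),
      ∀ n, (e n, (ev n : ℂ) • e n) ∈ T.graph.topologicalClosure := by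
  have hs := hT.topologicalClosure
  have hg := hc.graph_closure_eq_closure_graph
  have hsym : (R : E →ₗ[ℂ] E).IsSymmetric := by
    intro u v
    have := hs _ (hR u) _ (hR v)
    simp only [inner_sub_left, inner_sub_right, inner_smul_left, inner_smul_right,
      Complex.conj_ofReal] at this
    have h2 := sub_right_injective this
    exact h2.symm
  have hker : ∀ x, R x = 0 → x = 0 := fun x hx => hinj (by rw [hx, map_zero])
  obtain ⟨e, ev, h⟩ := exists_eigenbasis_of_blocks (T := T.closure) (by rwa [← hg])
    (fun μ : ℂ => Module.End.eigenspace (R : Module.End ℂ E) μ) (fun μ => by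
      by_cases hμ : μ = 0
      · have : Module.End.eigenspace (R : Module.End ℂ E) μ = ⊥ := by
          rw [eq_bot_iff]
          intro x hx
          rw [Module.End.mem_eigenspace_iff, hμ, zero_smul] at hx
          exact hker x hx
        rw [this]
        infer_instance
      · exact ContinuousLinearMap.finite_dimensional_eigenspace hRc μ hμ)
    (fun μ ν hμν x hx y hy => hsym.orthogonalFamily_eigenspaces hμν ⟨x, hx⟩ ⟨y, hy⟩)
    (ContinuousLinearMap.orthogonalComplement_iSup_eigenspaces_eq_bot hRc hsym)
    (fun μ x hx => by
      have hx' : R x = μ • x := Module.End.mem_eigenspace_iff.1 hx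
      by_cases hμ : μ = 0
      · have : x = 0 := hker x (by rw [hx', hμ, zero_smul])
        exact ⟨0, Submodule.zero_mem _, by rw [this]; exact Submodule.zero_mem _⟩
      -- `R x = μ x` with `R = (r - T)⁻¹` means `T x = (r - μ⁻¹) x`.
      · refine ⟨((r : ℂ) - μ⁻¹) • x, Submodule.smul_mem _ _ hx, ?_⟩
        rw [← hg]
        have h1 := T.graph.topologicalClosure.smul_mem μ⁻¹ (hR x)
        rw [Prod.smul_mk, hx', inv_smul_smul₀ hμ] at h1
        convert h1 using 2
        rw [smul_sub, smul_smul, smul_smul, sub_smul]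
        congr 2
        field_simp)
  exact ⟨_, e, ev, fun n => by rw [hg]; exact (h n).2⟩

variable {ι : Type*}

/-- The bounded operator that is diagonal in the basis `e` with bounded eigenvalues `d`. -/
def diagCLM (e : HilbertBasis ι ℂ E) (d : ι → ℂ) {C : ℝ} (hC : 0 ≤ C) (hd : ∀ n, ‖d n‖ ≤ C) :
    E →L[ℂ] E :=
  (e.repr.symm.toContinuousLinearEquiv : _ →L[ℂ] E) ∘L
    (lp.mapCLM 2 (fun n => d n • ContinuousLinearMap.id ℂ ℂ) hC
      (fun n => by rw [norm_smul, ContinuousLinearMap.norm_id, mul_one]; exact hd n)) ∘L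
    (e.repr.toContinuousLinearEquiv : E →L[ℂ] _)

theorem inner_diagCLM (e : HilbertBasis ι ℂ E) (d : ι → ℂ) {C : ℝ} (hC : 0 ≤ C)
    (hd : ∀ n, ‖d n‖ ≤ C) (n : ι) (ψ : E) :
    inner ℂ (e n) (diagCLM e d hC hd ψ) = d n * inner ℂ (e n) ψ := by
  rw [← e.repr_apply_apply, ← e.repr_apply_apply]
  simp [diagCLM]

theorem norm_diagCLM_le (e : HilbertBasis ι ℂ E) (d : ι → ℂ) {C : ℝ} (hC : 0 ≤ C)
    (hd : ∀ n, ‖d n‖ ≤ C) : ‖diagCLM e d hC hd‖ ≤ C := by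
  refine ContinuousLinearMap.opNorm_le_bound _ hC fun ψ => ?_
  have h := lp.norm_mapCLM_le 2 (fun n => d n • ContinuousLinearMap.id ℂ ℂ) hC
      (fun n => by rw [norm_smul, ContinuousLinearMap.norm_id, mul_one]; exact hd n)
  have h2 := ContinuousLinearMap.le_of_opNorm_le _ h (e.repr ψ)
  rw [e.repr.norm_map] at h2
  refine le_trans (le_of_eq ?_) h2
  exact e.repr.symm.norm_map _

/-- Norm limit of the finite-rank truncations `P s`: the remainder is again diagonal, and only
entries of size at most `ε/2` survive once `s` contains all larger ones. -/
theorem isCompactOperator_diagCLM [CompleteSpace E] (e : HilbertBasis ι ℂ E) (d : ι → ℂ) {C : ℝ}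
    (hC : 0 ≤ C) (hd : ∀ n, ‖d n‖ ≤ C) (h0 : Tendsto d cofinite (𝓝 0)) :
    IsCompactOperator (diagCLM e d hC hd) := by
  classical
  let P : Finset ι → E →L[ℂ] E := fun s =>
    ∑ n ∈ s, (d n • (innerSL ℂ (e n))).smulRight (e n)
  have hP : ∀ s n ψ, inner ℂ (e n) (P s ψ) = if n ∈ s then d n * inner ℂ (e n) ψ else 0 := by
    intro s n ψ
    simp only [P, sum_apply, ContinuousLinearMap.smulRight_apply, inner_sum,
      inner_smul_right, orthonormal_iff_ite.mp e.orthonormal, smul_apply,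
      innerSL_apply_apply, smul_eq_mul, mul_ite, mul_one, mul_zero, Finset.sum_ite_eq]
  have hPc : ∀ s, IsCompactOperator (P s) := by
    intro s
    induction s using Finset.induction_on with
    | empty => simpa [P] using! isCompactOperator_zero
    | insert a s ha ih =>
      have h1 : IsCompactOperator ((d a • (innerSL ℂ (e a))).smulRight (e a)) := by
        have h2 : IsCompactOperator (d a • (innerSL ℂ (e a)) : E →L[ℂ] ℂ) :=
          isCompactOperator_of_locallyCompactSpace_dom _
        exact h2.clm_comp (ContinuousLinearMap.toSpanSingleton ℂ (e a))
      have h3 : P (insert a s) = (d a • (innerSL ℂ (e a))).smulRight (e a) + P s :=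
        Finset.sum_insert ha
      rw [h3]
      exact h1.add ih
  refine isCompactOperator_of_tendsto (l := atTop) (F := P) ?_ (Eventually.of_forall hPc)
  rw [Metric.tendsto_atTop]
  intro ε hε
  have hfin : {n | ¬ ‖d n‖ < ε / 2}.Finite := by
    have := (tendsto_zero_iff_norm_tendsto_zero.1 h0).eventually (gt_mem_nhds (half_pos hε))
    exact this
  refine ⟨hfin.toFinset, fun s hs => ?_⟩
  have hd' : ∀ n, ‖if n ∈ s then 0 else -d n‖ ≤ ε / 2 := by
    intro n
    split_ifs with h
    · simp; positivity
    · rw [norm_neg]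
      by_contra h2
      exact h (hs (hfin.mem_toFinset.2 fun h3 => h2 h3.le))
  have h1 : P s - diagCLM e d hC hd = diagCLM e (fun n => if n ∈ s then 0 else -d n)
      (half_pos hε).le hd' := by
    ext ψ
    refine hilbertBasis_ext e fun n => ?_
    rw [sub_apply, inner_sub_right, hP, inner_diagCLM, inner_diagCLM]
    split_ifs <;> ring
  rw [dist_eq_norm, h1]
  exact (norm_diagCLM_le e _ _ hd').trans_lt (half_lt_self hε)

/-- Factor `r - T₀ - B = (1 - B R₀)(r - T₀)` with `R₀ = (r - T₀)⁻¹`; when `‖B R₀‖ < 1` the inverse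
is `R₀ (1 - B R₀)⁻¹`, which is compact because `R₀` is. -/
theorem exists_compact_resolvent_of_perturbation [CompleteSpace E] (e : HilbertBasis ι ℂ E)
    {ev : ι → ℝ} (hev : Tendsto ev cofinite atTop) (B : E →L[ℂ] E) {G : Submodule ℂ (E × E)}
    (hB : ∀ p ∈ diagGraph e ev, (p.1, p.2 + B p.1) ∈ G) :
    ∃ (r : ℝ) (R : E →L[ℂ] E), IsCompactOperator R ∧ Function.Injective R ∧
      ∀ u, (R u, (r : ℂ) • R u - u) ∈ G := by
  obtain ⟨m, hm⟩ : ∃ m, ∀ n, m ≤ ev n := by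
    have hfin : {n | ¬ 0 ≤ ev n}.Finite := hev.eventually_ge_atTop 0
    obtain ⟨m, hm⟩ := (hfin.image ev).bddBelow
    refine ⟨min m 0, fun n => ?_⟩
    by_cases h : 0 ≤ ev n
    · exact (min_le_right _ _).trans h
    · exact (min_le_left _ _).trans (hm ⟨n, h, rfl⟩)
  -- Placing `r` at distance `‖B‖ + 1` below a lower bound of the spectrum gives `‖R₀‖ ≤ (‖B‖ +
  -- 1)⁻¹`, hence a convergent Neumann series.
  set c := ‖B‖ + 1 with hc
  have hc0 : 0 < c := by positivity
  set r := m - c with hr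
  have hrc : ∀ n, c ≤ ev n - r := fun n => by have := hm n; rw [hr]; linarith
  let d : ι → ℂ := fun n => ((r - ev n : ℝ) : ℂ)⁻¹
  have hdn : ∀ n, ‖d n‖ = (ev n - r)⁻¹ := fun n => by
    have := hrc n
    rw [norm_inv, Complex.norm_real, Real.norm_eq_abs, abs_sub_comm, abs_of_pos (by linarith)]
  have hd : ∀ n, ‖d n‖ ≤ c⁻¹ := fun n => by
    rw [hdn]
    exact inv_anti₀ hc0 (hrc n)
  have hd0 : Tendsto d cofinite (𝓝 0) := by
    rw [tendsto_zero_iff_norm_tendsto_zero]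
    simp only [hdn]
    exact tendsto_inv_atTop_zero.comp (tendsto_atTop_add_const_right _ (-r) hev)
  have hne : ∀ n, ((r - ev n : ℝ) : ℂ) ≠ 0 := fun n => by
    have := hrc n
    rw [Ne, Complex.ofReal_eq_zero]
    linarith
  let R₀ := diagCLM e d (inv_nonneg.2 hc0.le) hd
  have hR₀ : ∀ v, (R₀ v, (r : ℂ) • R₀ v - v) ∈ diagGraph e ev := by
    intro v n
    simp only [R₀, inner_sub_right, inner_smul_right, inner_diagCLM, d]
    have := hne n
    push_cast at this ⊢
    field_simp
    ring
  have hR₀inj : ∀ v, R₀ v = 0 → v = 0 := by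
    intro v hv
    refine hilbertBasis_ext e fun n => ?_
    have h := inner_diagCLM e d (inv_nonneg.2 hc0.le) hd n v
    change inner ℂ (e n) (R₀ v) = _ at h
    rw [hv, inner_zero_right, eq_comm, mul_eq_zero] at h
    rw [inner_zero_right]
    exact h.resolve_left (inv_ne_zero (hne n))
  have hnorm : ‖B * R₀‖ < 1 := by
    have h1 : ‖R₀‖ ≤ c⁻¹ := norm_diagCLM_le e d _ hd
    calc ‖B * R₀‖ ≤ ‖B‖ * ‖R₀‖ := norm_mul_le _ _
      _ ≤ ‖B‖ * c⁻¹ := by gcongr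
      _ < 1 := by rw [← div_eq_mul_inv, div_lt_one hc0, hc]; linarith
  obtain ⟨W, hW⟩ : ∃ W : E →L[ℂ] E, (1 - B * R₀) * W = 1 :=
    (isUnit_one_sub_of_norm_lt_one hnorm).exists_right_inv
  have hW1 : ∀ u, W u - B (R₀ (W u)) = u := fun u => by
    simpa using DFunLike.congr_fun hW u
  refine ⟨r, R₀ * W, ?_, ?_, fun u => ?_⟩
  · exact (isCompactOperator_diagCLM e d _ hd hd0).comp_clm _
  · rw [injective_iff_map_eq_zero]
    intro u hu
    have h2 := hW1 u
    have h3 : W u = 0 := hR₀inj _ hu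
    rw [h3] at h2
    simpa using h2.symm
  · have h1 := hB _ (hR₀ (W u))
    have h2 : (r : ℂ) • R₀ (W u) - u = (r : ℂ) • R₀ (W u) - W u + B (R₀ (W u)) := by
      nth_rewrite 2 [← hW1 u]
      abel
    change (R₀ (W u), (r : ℂ) • R₀ (W u) - u) ∈ G
    rw [h2]
    exact h1

end Resolvents

end JCH

namespace JCH

open MeasureTheory Filter Topology
open scoped SchwartzMap ContDiff LineDeriv

/-! ### Hermite functions, ladder operators and atomic operators on number states. -/

section NumberStates

theorem derivative_hermite_succ (n : ℕ) :
    Polynomial.derivative (Polynomial.hermite (n + 1)) =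
      ((n + 1 : ℕ) : Polynomial ℤ) * Polynomial.hermite n := by
  induction n with
  | zero => simp
  | succ n ih =>
    rw [Polynomial.hermite_succ (n + 1), Polynomial.derivative_sub, Polynomial.derivative_mul,
      Polynomial.derivative_X, ih, Polynomial.derivative_mul, Polynomial.derivative_natCast,
      Polynomial.hermite_succ n]
    push_cast
    ring

theorem hasDerivAt_hermiteFunction (n : ℕ) (x : ℝ) :
    HasDerivAt (hermiteFunction n)
      ((Real.sqrt ((n.factorial : ℝ) * Real.sqrt Real.pi))⁻¹ * (Real.sqrt 2 *
        Polynomial.aeval (Real.sqrt 2 * x) (Polynomial.derivative (Polynomial.hermite n)) -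
        x * Polynomial.aeval (Real.sqrt 2 * x) (Polynomial.hermite n)) *
          Real.exp (-(x ^ 2) / 2)) x := by
  have h1 : HasDerivAt (fun x : ℝ => Real.sqrt 2 * x) (Real.sqrt 2) x := by
    simpa using (hasDerivAt_id x).const_mul (Real.sqrt 2)
  have h2 := ((Polynomial.hermite n).hasDerivAt_aeval (Real.sqrt 2 * x)).comp x h1
  have h3 : HasDerivAt (fun x : ℝ => Real.exp (-(x ^ 2) / 2)) (Real.exp (-(x ^ 2) / 2) * -x) x := by
    have h4 : HasDerivAt (fun x : ℝ => -(x ^ 2) / 2) (-x) x := by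
      have := ((hasDerivAt_pow 2 x).neg.div_const 2)
      refine this.congr_deriv ?_
      simp
      ring
    exact h4.exp
  refine ((h2.const_mul _).mul h3).congr_deriv ?_
  simp only [Function.comp]
  ring

theorem sqrt_factorial_succ (n : ℕ) :
    Real.sqrt (((n + 1).factorial : ℝ) * Real.sqrt Real.pi) =
      Real.sqrt (n + 1) * Real.sqrt ((n.factorial : ℝ) * Real.sqrt Real.pi) := by
  rw [← Real.sqrt_mul (by positivity), Nat.factorial_succ]
  push_cast
  ring_nf

/-- The derivative of the Gaussian contributes a second `x`, and the recursion `He_{n+1} = X He_n -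
He_n'` does the rest. -/
theorem hermiteFunction_raise (n : ℕ) (x : ℝ) :
    x * hermiteFunction n x - deriv (hermiteFunction n) x =
      Real.sqrt 2 * Real.sqrt (n + 1) * hermiteFunction (n + 1) x := by
  have hs : Real.sqrt (n + 1) ≠ 0 := by positivity
  have h2 : Real.sqrt 2 * Real.sqrt 2 = 2 := Real.mul_self_sqrt (by norm_num)
  rw [(hasDerivAt_hermiteFunction n x).deriv, hermiteFunction, hermiteFunction,
    sqrt_factorial_succ, Polynomial.hermite_succ, map_sub, map_mul, Polynomial.aeval_X, mul_inv]
  generalize Polynomial.aeval (Real.sqrt 2 * x) (Polynomial.hermite n) = p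
  field_simp
  linear_combination -(p * x) * h2

/-- Here the two `x` terms cancel and `He_n' = n He_{n-1}` remains. At `n = 0` the truncated `n - 1`
does no harm because its coefficient `√0` vanishes. -/
theorem hermiteFunction_lower (n : ℕ) (x : ℝ) :
    x * hermiteFunction n x + deriv (hermiteFunction n) x =
      Real.sqrt 2 * Real.sqrt n * hermiteFunction (n - 1) x := by
  rw [(hasDerivAt_hermiteFunction n x).deriv]
  cases n with
  | zero => simp [hermiteFunction]; ring
  | succ n =>
    have hs : Real.sqrt (n + 1) ≠ 0 := by positivity
    have h2 : Real.sqrt (n + 1) * Real.sqrt (n + 1) = n + 1 := Real.mul_self_sqrt (by positivity)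
    rw [derivative_hermite_succ, hermiteFunction, hermiteFunction, sqrt_factorial_succ, map_mul,
      map_natCast, mul_inv, Nat.add_sub_cancel]
    generalize Polynomial.aeval (Real.sqrt 2 * x) (Polynomial.hermite n) = p
    generalize Polynomial.aeval (Real.sqrt 2 * x) (Polynomial.hermite (n + 1)) = q
    push_cast
    field_simp
    linear_combination -(Real.sqrt 2 * p) * h2

variable {M : ℕ}

theorem numberState_apply_erase (m : Fin M → ℕ) (b : Fin M → Fin 2) (i : Fin M) (x : Conf M) :
    numberState m b x = hermiteFunction (m i) (x i) •
      (∏ j ∈ Finset.univ.erase i, hermiteFunction (m j) (x j)) •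
        (EuclideanSpace.single b (1 : ℂ) : Atoms M) := by
  rw [numberState_apply, smul_smul, Finset.mul_prod_erase _ (fun j => hermiteFunction (m j) (x j)) (Finset.mem_univ i)]

theorem numberState_update_apply (m : Fin M → ℕ) (b : Fin M → Fin 2) (i : Fin M) (n : ℕ)
    (x : Conf M) :
    numberState (Function.update m i n) b x = hermiteFunction n (x i) •
      (∏ j ∈ Finset.univ.erase i, hermiteFunction (m j) (x j)) •
        (EuclideanSpace.single b (1 : ℂ) : Atoms M) := by
  rw [numberState_apply_erase _ _ i, Function.update_self]
  congr 2
  refine Finset.prod_congr rfl fun j hj => ?_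
  rw [Function.update_of_ne (Finset.ne_of_mem_erase hj)]

theorem partialDeriv_numberState_apply (m : Fin M → ℕ) (b : Fin M → Fin 2) (i : Fin M)
    (x : Conf M) :
    partialDeriv i (numberState m b) x = deriv (hermiteFunction (m i)) (x i) •
      (∏ j ∈ Finset.univ.erase i, hermiteFunction (m j) (x j)) •
        (EuclideanSpace.single b (1 : ℂ) : Atoms M) := by
  rw [partialDeriv_apply, lineDeriv]
  have h1 : (fun t : ℝ => numberState m b (x + t • EuclideanSpace.single i (1 : ℝ))) =
      fun t : ℝ => hermiteFunction (m i) (x i + t) •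
      (∏ j ∈ Finset.univ.erase i, hermiteFunction (m j) (x j)) •
        (EuclideanSpace.single b (1 : ℂ) : Atoms M) := by
    funext t
    rw [numberState_apply_erase m b i]
    congr 2
    · simp
    · refine Finset.prod_congr rfl fun j hj => ?_
      simp [Finset.ne_of_mem_erase hj]
  rw [h1]
  have h2 : HasDerivAt (fun t : ℝ => hermiteFunction (m i) (x i + t))
      (deriv (hermiteFunction (m i)) (x i)) 0 := by
    refine HasDerivAt.comp_const_add (x i) 0 ?_
    rw [add_zero]
    exact (hasDerivAt_hermiteFunction (m i) (x i)).differentiableAt.hasDerivAt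
  exact (h2.smul_const _).deriv

theorem creation_numberState (m : Fin M → ℕ) (b : Fin M → Fin 2) (i : Fin M) :
    creation i (numberState m b) =
      ((Real.sqrt (m i + 1) : ℝ) : ℂ) • numberState (Function.update m i (m i + 1)) b := by
  ext1 x
  change ((Real.sqrt 2 : ℝ) : ℂ)⁻¹ • (position i (numberState m b) x -
    partialDeriv i (numberState m b) x) = ((Real.sqrt (m i + 1) : ℝ) : ℂ) • _
  rw [position_apply, partialDeriv_numberState_apply, numberState_apply_erase m b i,
    numberState_update_apply]
  generalize (∏ j ∈ Finset.univ.erase i, hermiteFunction (m j) (x j)) •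
    (EuclideanSpace.single b (1 : ℂ) : Atoms M) = v
  rw [Complex.coe_smul, Complex.coe_smul, smul_smul, ← sub_smul, hermiteFunction_raise,
    ← Complex.ofReal_inv, Complex.coe_smul, smul_smul, smul_smul]
  congr 1
  field_simp

theorem annihilation_numberState (m : Fin M → ℕ) (b : Fin M → Fin 2) (i : Fin M) :
    annihilation i (numberState m b) =
      ((Real.sqrt (m i) : ℝ) : ℂ) • numberState (Function.update m i (m i - 1)) b := by
  ext1 x
  change ((Real.sqrt 2 : ℝ) : ℂ)⁻¹ • (position i (numberState m b) x +
    partialDeriv i (numberState m b) x) = ((Real.sqrt (m i) : ℝ) : ℂ) • _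
  rw [position_apply, partialDeriv_numberState_apply, numberState_apply_erase m b i,
    numberState_update_apply]
  generalize (∏ j ∈ Finset.univ.erase i, hermiteFunction (m j) (x j)) •
    (EuclideanSpace.single b (1 : ℂ) : Atoms M) = v
  rw [Complex.coe_smul, Complex.coe_smul, smul_smul, ← add_smul, hermiteFunction_lower,
    ← Complex.ofReal_inv, Complex.coe_smul, smul_smul, smul_smul]
  congr 1
  field_simp

/-- The identity factors vanish unless `s` and `b` agree away from site `i`, so a column involves
only the updates of `b` at `i`. -/
theorem siteMatrix_apply (A : Matrix (Fin 2) (Fin 2) ℂ) (i : Fin M) (s b : Fin M → Fin 2) :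
    siteMatrix A i s b = ∑ c, A c (b i) * if s = Function.update b i c then 1 else 0 := by
  have h0 : ∀ c, s = Function.update b i c → c = s i := fun c h => by
    rw [h, Function.update_self]
  by_cases h : s = Function.update b i (s i)
  · rw [Finset.sum_eq_single (s i) (fun c _ hc => by
      rw [if_neg (fun h' => hc (h0 c h')), mul_zero]) (fun h' => absurd (Finset.mem_univ _) h'),
      if_pos h, mul_one, siteMatrix, Matrix.of_apply, Finset.prod_eq_single i, if_pos rfl]
    · intro j _ hj
      rw [if_neg hj, h, Function.update_of_ne hj, Matrix.one_apply_eq]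
    · exact fun h' => absurd (Finset.mem_univ _) h'
  · rw [Finset.sum_eq_zero fun c _ => by
      rw [if_neg (fun h' => h (by rw [← h0 c h']; exact h')), mul_zero]]
    obtain ⟨j, hj⟩ := Function.ne_iff.1 h
    have hji : j ≠ i := fun h' => hj (by rw [h', Function.update_self])
    rw [Function.update_of_ne hji] at hj
    rw [siteMatrix, Matrix.of_apply]
    exact Finset.prod_eq_zero (Finset.mem_univ j) (by rw [if_neg hji, Matrix.one_apply_ne hj])

theorem atomOp_apply (A : Matrix (Fin 2) (Fin 2) ℂ) (i : Fin M) (f : Sch M) (x : Conf M) :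
    atomOp A i f x = Matrix.toEuclideanCLM (𝕜 := ℂ) (siteMatrix A i) (f x) := rfl

theorem atomOp_numberState (A : Matrix (Fin 2) (Fin 2) ℂ) (i : Fin M) (m : Fin M → ℕ)
    (b : Fin M → Fin 2) :
    atomOp A i (numberState m b) =
      ∑ c, A c (b i) • numberState m (Function.update b i c) := by
  ext x s
  rw [atomOp_apply, numberState_apply, Matrix.ofLp_toEuclideanCLM]
  have h2 : (∑ c, A c (b i) • numberState m (Function.update b i c)) x =
    ∑ c, A c (b i) • (numberState m (Function.update b i c) x) := by
    rw [sum_apply]; rfl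
  rw [h2]
  simp only [numberState_apply]
  simp [Matrix.mulVec_smul, siteMatrix_apply, mul_comm]

end NumberStates

/-! ### Formal adjoints on Schwartz functions. -/

section Adjoints

variable {M : ℕ}

theorem incl_coeFn (f : Sch M) : (incl M f : Conf M → Atoms M) =ᵐ[volume] f :=
  SchwartzMap.coeFn_toLp f 2 volume

theorem inner_incl (f g : Sch M) :
    inner ℂ (incl M f) (incl M g) = ∫ x, (inner ℂ (f x) (g x) : ℂ) := by
  rw [L2.inner_def]
  refine integral_congr_ae ?_
  filter_upwards [incl_coeFn f, incl_coeFn g] with x h1 h2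
  rw [h1, h2]

theorem inner_incl_position (i : Fin M) (f g : Sch M) :
    inner ℂ (incl M (position i f)) (incl M g) =
      (inner ℂ (incl M f) (incl M (position i g)) : ℂ) := by
  rw [inner_incl, inner_incl]
  refine integral_congr_ae (Eventually.of_forall fun x => ?_)
  simp only [position_apply, inner_smul_left, inner_smul_right, Complex.conj_ofReal]

/-- Integration by parts without boundary terms for Schwartz functions. -/
theorem inner_incl_partialDeriv (i : Fin M) (f g : Sch M) :
    inner ℂ (incl M (partialDeriv i f)) (incl M g) =
      -(inner ℂ (incl M f) (incl M (partialDeriv i g)) : ℂ) := by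
  rw [inner_incl, inner_incl]
  have := SchwartzMap.integral_bilinear_lineDerivOp_right_eq_neg_left (μ := volume) f g
    (isBoundedBilinearMap_inner (𝕜 := ℂ) (E := Atoms M)).toContinuousLinearMap
    (EuclideanSpace.single i (1 : ℝ) : Conf M)
  exact (neg_eq_iff_eq_neg.2 this).symm

theorem inner_incl_annihilation (i : Fin M) (f g : Sch M) :
    inner ℂ (incl M (annihilation i f)) (incl M g) =
      (inner ℂ (incl M f) (incl M (creation i g)) : ℂ) := by
  simp only [annihilation, creation, LinearMap.smul_apply, LinearMap.add_apply,
    LinearMap.sub_apply, map_smul, map_add, map_sub, inner_smul_left, inner_smul_right,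
    inner_add_left, inner_sub_right, inner_incl_position, inner_incl_partialDeriv, map_inv₀,
    Complex.conj_ofReal]
  ring

theorem inner_incl_creation (i : Fin M) (f g : Sch M) :
    inner ℂ (incl M (creation i f)) (incl M g) =
      (inner ℂ (incl M f) (incl M (annihilation i g)) : ℂ) := by
  rw [← inner_conj_symm, ← inner_incl_annihilation, inner_conj_symm]

theorem siteMatrix_conjTranspose (A : Matrix (Fin 2) (Fin 2) ℂ) (i : Fin M) :
    siteMatrix A.conjTranspose i = (siteMatrix A i).conjTranspose := by
  ext s t
  simp only [siteMatrix, Matrix.of_apply, Matrix.conjTranspose_apply, star_prod]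
  refine Finset.prod_congr rfl fun j _ => ?_
  split_ifs
  · rfl
  · rw [Matrix.one_apply, Matrix.one_apply]
    split_ifs <;> simp_all

/-- The bounded operator on the Hilbert space that acts as `A` on the `i`-th atom. -/
def atomCLM (A : Matrix (Fin 2) (Fin 2) ℂ) (i : Fin M) : Hil M →L[ℂ] Hil M :=
  (Matrix.toEuclideanCLM (𝕜 := ℂ) (siteMatrix A i)).compLpL 2 volume

theorem incl_atomOp (A : Matrix (Fin 2) (Fin 2) ℂ) (i : Fin M) (f : Sch M) :
    incl M (atomOp A i f) = atomCLM A i (incl M f) := by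
  refine Lp.ext ?_
  filter_upwards [incl_coeFn (atomOp A i f), incl_coeFn f,
    (Matrix.toEuclideanCLM (𝕜 := ℂ) (siteMatrix A i)).coeFn_compLpL (p := 2) (μ := volume)
      (incl M f)] with x h1 h2 h3
  rw [h1, atomCLM, h3, h2, atomOp_apply]

theorem inner_incl_atomOp (A : Matrix (Fin 2) (Fin 2) ℂ) (i : Fin M) (f g : Sch M) :
    inner ℂ (incl M (atomOp A i f)) (incl M g) =
      (inner ℂ (incl M f) (incl M (atomOp A.conjTranspose i g)) : ℂ) := by
  rw [inner_incl, inner_incl]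
  refine integral_congr_ae (Eventually.of_forall fun x => ?_)
  simp only [atomOp_apply]
  rw [siteMatrix_conjTranspose, ← Matrix.star_eq_conjTranspose, map_star,
    ContinuousLinearMap.star_eq_adjoint, ContinuousLinearMap.adjoint_inner_right]

end Adjoints

end JCH

namespace JCH

open MeasureTheory Filter Topology
open scoped SchwartzMap ContDiff LineDeriv FourierTransform

/-! ### Completeness of the number states. -/

section Totality

/-- Every test function is `𝓕 χ` for a Schwartz `χ`, and `∫ (𝓕 χ) h = ∫ χ (𝓕 h) = 0`; this avoids
inversion for a merely integrable `h`. -/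
theorem ae_eq_zero_of_fourier_eq_zero {V : Type*} [NormedAddCommGroup V] [InnerProductSpace ℝ V]
    [FiniteDimensional ℝ V] [MeasurableSpace V] [BorelSpace V] {h : V → ℂ} (hh : Integrable h)
    (h0 : ∀ w, 𝓕 h w = 0) : ∀ᵐ x, h x = 0 := by
  refine ae_eq_zero_of_integral_contDiff_smul_eq_zero hh.locallyIntegrable fun g hg hgc => ?_
  have hc : HasCompactSupport (fun x => (g x : ℂ)) := hgc.comp_left Complex.ofReal_zero
  let φ : 𝓢(V, ℂ) := hc.toSchwartzMap (Complex.ofRealCLM.contDiff.comp hg)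
  have hφ : ∀ x, φ x = g x := fun x => rfl
  let χ : 𝓢(V, ℂ) := 𝓕⁻ φ
  have hχ : 𝓕 χ = φ := FourierTransform.fourier_fourierInv_eq φ
  have key := VectorFourier.integral_fourierIntegral_smul_eq_flip (μ := volume) (ν := volume)
    (L := innerₗ V) Real.continuous_fourierChar continuous_inner χ.integrable hh
  have h1 : VectorFourier.fourierIntegral Real.fourierChar volume (innerₗ V) χ = φ := by
    rw [← hχ, SchwartzMap.fourier_coe]
    rfl
  have h2 : VectorFourier.fourierIntegral Real.fourierChar volume (innerₗ V).flip h = 0 := by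
    funext w
    rw [flip_innerₗ]
    exact h0 w
  rw [h1, h2] at key
  simp only [Pi.zero_apply, smul_zero, integral_zero, hφ] at key
  simpa only [Complex.coe_smul] using key

variable {M : ℕ}

/-- Completing the square turns `e^{⟨ξ,x⟩}` times the Gaussian into a multiple of a translated
Gaussian; the absolute value is covered by adding the cases `ξ` and `-ξ`. -/
theorem memLp_exp_inner_mul_gaussian (ξ : Conf M) :
    MemLp (fun x => Real.exp |inner ℝ ξ x| * gaussian M x) 2 := by
  have h1 : ∀ ξ : Conf M, MemLp (fun x => Real.exp (inner ℝ ξ x) * gaussian M x) 2 := by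
    intro ξ
    have h2 : (fun x => Real.exp (inner ℝ ξ x) * gaussian M x) =
        fun x => Real.exp (‖ξ‖ ^ 2 / 2) * gaussian M (x - ξ) := by
      funext x
      change Real.exp _ * Real.exp (-(‖x‖ ^ 2) / 2) = _ * Real.exp (-(‖x - ξ‖ ^ 2) / 2)
      rw [← Real.exp_add, ← Real.exp_add, norm_sub_sq_real, real_inner_comm]
      congr 1
      ring
    rw [h2]
    exact (((gaussian M).memLp 2).comp_measurePreserving
      (measurePreserving_sub_right volume ξ)).const_mul _
  have h3 := (h1 ξ).add (h1 (-ξ))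
  refine h3.mono ?_ (Eventually.of_forall fun x => ?_)
  · exact (by fun_prop : Continuous fun x => Real.exp |inner ℝ ξ x| * gaussian M x)
      |>.aestronglyMeasurable
  · have hg : 0 < gaussian M x := Real.exp_pos _
    rw [Real.norm_of_nonneg (by positivity), Pi.add_apply, ← add_mul,
      Real.norm_of_nonneg (by positivity), inner_neg_left]
    refine mul_le_mul_of_nonneg_right ?_ hg.le
    rcases abs_choice (inner ℝ ξ x : ℝ) with h | h <;> rw [h]
    · exact le_add_of_nonneg_right (Real.exp_pos _).le
    · exact le_add_of_nonneg_left (Real.exp_pos _).le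

/-- Expand the Fourier kernel in its exponential series and integrate termwise: the moments vanish,
and `e^{|⟨ξ,x⟩|}` times the Gaussian dominates the partial sums. -/
theorem fourier_gaussian_mul_eq_zero {u : Conf M → ℂ} (hu : MemLp u 2)
    (h : ∀ (ξ : Conf M) (k : ℕ),
      ∫ x, ((inner ℝ ξ x : ℝ) : ℂ) ^ k * ((gaussian M x : ℝ) : ℂ) * u x = 0) (w : Conf M) :
    𝓕 (fun x => ((gaussian M x : ℝ) : ℂ) * u x) w = 0 := by
  set ξ : Conf M := (-2 * Real.pi) • w with hξ
  have hint : Integrable (fun x => Real.exp |inner ℝ ξ x| * ‖((gaussian M x : ℝ) : ℂ) * u x‖) := by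
    have := (memLp_exp_inner_mul_gaussian ξ).integrable_mul hu.norm
    refine this.congr (Eventually.of_forall fun x => ?_)
    have hg : 0 < gaussian M x := Real.exp_pos _
    simp only [Pi.mul_apply, norm_mul, Complex.norm_real, Real.norm_of_nonneg hg.le, mul_assoc]
  have hs : ∀ x, HasSum (fun k : ℕ => (Complex.I * (inner ℝ ξ x : ℝ)) ^ k / (k.factorial : ℂ) *
      (((gaussian M x : ℝ) : ℂ) * u x))
      (Complex.exp (Complex.I * (inner ℝ ξ x : ℝ)) * (((gaussian M x : ℝ) : ℂ) * u x)) := by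
    intro x
    refine HasSum.mul_right _ ?_
    rw [Complex.exp_eq_exp_ℂ]
    exact NormedSpace.expSeries_div_hasSum_exp _
  have hb : ∀ x, HasSum (fun k : ℕ => |inner ℝ ξ x| ^ k / (k.factorial : ℝ) *
      ‖((gaussian M x : ℝ) : ℂ) * u x‖)
      (Real.exp |inner ℝ ξ x| * ‖((gaussian M x : ℝ) : ℂ) * u x‖) := by
    intro x
    refine HasSum.mul_right _ ?_
    rw [Real.exp_eq_exp_ℝ]
    exact NormedSpace.expSeries_div_hasSum_exp _
  have hmeas : AEStronglyMeasurable (fun x => ((gaussian M x : ℝ) : ℂ) * u x) volume :=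
    ((Complex.continuous_ofReal.comp (gaussian M).continuous).aestronglyMeasurable).mul
      hu.aestronglyMeasurable
  have key := hasSum_integral_of_dominated_convergence (μ := (volume : Measure (Conf M)))
    (F := fun (k : ℕ) x => (Complex.I * (inner ℝ ξ x : ℝ)) ^ k / (k.factorial : ℂ) *
      (((gaussian M x : ℝ) : ℂ) * u x))
    (fun k x => |inner ℝ ξ x| ^ k / (k.factorial : ℝ) * ‖((gaussian M x : ℝ) : ℂ) * u x‖)
    (fun k => (Continuous.aestronglyMeasurable (by fun_prop)).mul hmeas)
    (fun k => Eventually.of_forall fun x => by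
      rw [norm_mul, norm_div, norm_pow, norm_mul, Complex.norm_I, one_mul, Complex.norm_real,
        Complex.norm_natCast, Real.norm_eq_abs])
    (Eventually.of_forall fun x => (hb x).summable)
    (hint.congr (Eventually.of_forall fun x => (hb x).tsum_eq.symm))
    (Eventually.of_forall hs)
  have hz : ∀ k : ℕ, ∫ x, (Complex.I * (inner ℝ ξ x : ℝ)) ^ k / (k.factorial : ℂ) *
      (((gaussian M x : ℝ) : ℂ) * u x) = 0 := by
    intro k
    have h1 : ∀ x, (Complex.I * (inner ℝ ξ x : ℝ)) ^ k / (k.factorial : ℂ) *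
      (((gaussian M x : ℝ) : ℂ) * u x) = (Complex.I ^ k / (k.factorial : ℂ)) *
        (((inner ℝ ξ x : ℝ) : ℂ) ^ k * ((gaussian M x : ℝ) : ℂ) * u x) := fun x => by ring
    simp only [h1]
    rw [integral_const_mul, h, mul_zero]
  simp only [hz] at key
  rw [Real.fourier_eq']
  refine Eq.trans ?_ (key.unique hasSum_zero)
  refine integral_congr_ae (Eventually.of_forall fun x => ?_)
  simp only [smul_eq_mul]
  congr 2
  rw [hξ, inner_smul_left, real_inner_comm]
  simp
  ring

theorem annihilation_mem_finiteExcitation {f : Sch M} (hf : f ∈ finiteExcitation M) (i : Fin M) :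
    annihilation i f ∈ finiteExcitation M := by
  revert f
  change finiteExcitation M ≤ (finiteExcitation M).comap (annihilation i)
  refine Submodule.span_le.2 ?_
  rintro _ ⟨p, rfl⟩
  change annihilation i _ ∈ finiteExcitation M
  rw [annihilation_numberState]
  exact Submodule.smul_mem _ _ (Submodule.subset_span ⟨(_, _), rfl⟩)

theorem creation_mem_finiteExcitation {f : Sch M} (hf : f ∈ finiteExcitation M) (i : Fin M) :
    creation i f ∈ finiteExcitation M := by
  revert f
  change finiteExcitation M ≤ (finiteExcitation M).comap (creation i)
  refine Submodule.span_le.2 ?_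
  rintro _ ⟨p, rfl⟩
  change creation i _ ∈ finiteExcitation M
  rw [creation_numberState]
  exact Submodule.smul_mem _ _ (Submodule.subset_span ⟨(_, _), rfl⟩)

/-- Because `x = (a + a*)/√2`. This puts polynomial multiples of the vacuum into the finite
excitation subspace. -/
theorem position_mem_finiteExcitation {f : Sch M} (hf : f ∈ finiteExcitation M) (i : Fin M) :
    position i f ∈ finiteExcitation M := by
  have h0 : ((Real.sqrt 2 : ℝ) : ℂ) ≠ 0 := by
    rw [Ne, Complex.ofReal_eq_zero]; positivity
  have h : position i f =
      (((Real.sqrt 2 : ℝ) : ℂ) / 2) • (annihilation i f + creation i f) := by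
    simp only [annihilation, creation, LinearMap.smul_apply, LinearMap.add_apply,
      LinearMap.sub_apply]
    rw [← smul_add, smul_smul, add_add_sub_cancel, ← two_smul ℂ (position i f), smul_smul]
    field_simp
    rw [one_smul]
  rw [h]
  exact Submodule.smul_mem _ _ (add_mem (annihilation_mem_finiteExcitation hf i)
    (creation_mem_finiteExcitation hf i))

/-- Multiplication by the linear form `x ↦ ⟨ξ, x⟩`. -/
def formMul (ξ : Conf M) : Module.End ℂ (Sch M) := ∑ i, ((ξ i : ℝ) : ℂ) • position i

theorem formMul_apply (ξ : Conf M) (f : Sch M) (x : Conf M) :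
    formMul ξ f x = ((inner ℝ ξ x : ℝ) : ℂ) • f x := by
  have h1 : formMul ξ f x = ∑ i, ((ξ i : ℝ) : ℂ) • (position i f x) := by
    rw [formMul, LinearMap.sum_apply, sum_apply]
    rfl
  rw [h1]
  simp only [position_apply, smul_smul]
  rw [← Finset.sum_smul, PiLp.inner_apply]
  congr 1
  simp [mul_comm]

theorem formMul_pow_apply (ξ : Conf M) (k : ℕ) (f : Sch M) (x : Conf M) :
    (formMul ξ ^ k) f x = ((inner ℝ ξ x : ℝ) : ℂ) ^ k • f x := by
  induction k with
  | zero => simp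
  | succ k ih => rw [pow_succ', Module.End.mul_apply, formMul_apply, ih, smul_smul, ← pow_succ']

theorem formMul_pow_mem_finiteExcitation (ξ : Conf M) (k : ℕ) {f : Sch M}
    (hf : f ∈ finiteExcitation M) : (formMul ξ ^ k) f ∈ finiteExcitation M := by
  induction k with
  | zero => simpa using hf
  | succ k ih =>
    rw [pow_succ', Module.End.mul_apply, formMul, LinearMap.sum_apply]
    exact Submodule.sum_mem _ fun i _ =>
      Submodule.smul_mem _ _ (position_mem_finiteExcitation ih i)

theorem numberState_zero_apply (b : Fin M → Fin 2) (x : Conf M) :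
    numberState 0 b x = (((Real.sqrt (Real.sqrt Real.pi))⁻¹ ^ M * gaussian M x : ℝ) : ℂ) •
      (EuclideanSpace.single b (1 : ℂ) : Atoms M) := by
  have hg : gaussian M x = ∏ i, Real.exp (-(x i ^ 2) / 2) := by
    rw [← Real.exp_sum]
    change Real.exp (-(‖x‖ ^ 2) / 2) = _
    rw [EuclideanSpace.real_norm_sq_eq, ← Finset.sum_div, Finset.sum_neg_distrib]
  rw [numberState_apply, hg, Complex.coe_smul]
  congr 1
  simp [hermiteFunction, Finset.prod_mul_distrib]

/-- The number states are total. -/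
theorem eq_zero_of_inner_numberState {ψ : Hil M}
    (h : ∀ m b, inner ℂ (incl M (numberState m b)) ψ = (0 : ℂ)) : ψ = 0 := by
  have hD : ∀ f ∈ finiteExcitation M, inner ℂ (incl M f) ψ = (0 : ℂ) := by
    intro f hf
    induction hf using Submodule.span_induction with
    | mem x hx => obtain ⟨p, rfl⟩ := hx; exact h _ _
    | zero => simp
    | add x y _ _ hx hy => rw [map_add, inner_add_left, hx, hy, add_zero]
    | smul c x _ hx => rw [map_smul, inner_smul_left, hx, mul_zero]
  set c := (Real.sqrt (Real.sqrt Real.pi))⁻¹ ^ M with hc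
  have hc0 : (c : ℂ) ≠ 0 := by
    rw [Ne, Complex.ofReal_eq_zero]
    have := Real.pi_pos
    positivity
  have hcomp : ∀ b : Fin M → Fin 2, ∀ᵐ x, ψ x b = 0 := by
    intro b
    have hu : MemLp (fun x => ψ x b) 2 :=
      (Lp.memLp ψ).continuousLinearMap_comp (EuclideanSpace.proj b : Atoms M →L[ℂ] ℂ)
    -- Powers of a linear form times the vacuum with atomic state `b` are finite excitation vectors,
    -- and the vacuum is a multiple of the Gaussian, so orthogonality says exactly that these
    -- moments vanish.
    have hmom : ∀ (ξ : Conf M) (k : ℕ),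
        ∫ x, ((inner ℝ ξ x : ℝ) : ℂ) ^ k * ((gaussian M x : ℝ) : ℂ) * ψ x b = 0 := by
      intro ξ k
      have h1 := hD _ (formMul_pow_mem_finiteExcitation ξ k
        (Submodule.subset_span ⟨((0 : Fin M → ℕ), b), rfl⟩))
      rw [L2.inner_def] at h1
      have h2 : ∫ x, (inner ℂ (incl M ((formMul ξ ^ k) (numberState 0 b)) x) (ψ x) : ℂ) =
          ∫ x, (c : ℂ) * (((inner ℝ ξ x : ℝ) : ℂ) ^ k * ((gaussian M x : ℝ) : ℂ) * ψ x b) := by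
        refine integral_congr_ae ?_
        filter_upwards [incl_coeFn ((formMul ξ ^ k) (numberState 0 b))] with x hx
        rw [hx, formMul_pow_apply, numberState_zero_apply, smul_smul, inner_smul_left,
          EuclideanSpace.inner_single_left]
        simp only [map_mul, map_pow, Complex.conj_ofReal, map_one, one_mul]
        rw [← hc]
        push_cast
        ring
      rw [h2, integral_const_mul] at h1
      exact (mul_eq_zero.1 h1).resolve_left hc0
    have hint : Integrable (fun x => ((gaussian M x : ℝ) : ℂ) * ψ x b) :=
      (((gaussian M).memLp 2).ofReal (K := ℂ)).integrable_mul hu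
    filter_upwards [ae_eq_zero_of_fourier_eq_zero hint (fourier_gaussian_mul_eq_zero hu hmom)]
      with x hx
    refine (mul_eq_zero.1 hx).resolve_left ?_
    rw [Complex.ofReal_eq_zero]
    exact (Real.exp_pos _).ne'
  refine Lp.ext ?_
  filter_upwards [ae_all_iff.2 hcomp, Lp.coeFn_zero (Atoms M) 2 volume] with x hx h0
  rw [h0]
  ext b
  exact hx b

end Totality

end JCH

namespace JCH

open MeasureTheory Filter Topology

/-! ### The conserved excitation number and its finite-dimensional eigenspaces. -/

section Grading

variable {M : ℕ}

theorem sum_update_apply {α : Type*} (g : α → ℤ) (f : Fin M → α) (i : Fin M) (a : α) :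
    ∑ j, g (Function.update f i a j) = ∑ j, g (f j) + (g a - g (f i)) := by
  rw [← Finset.add_sum_erase _ _ (Finset.mem_univ i),
    ← Finset.add_sum_erase _ (fun j => g (f j)) (Finset.mem_univ i), Function.update_self,
    Finset.sum_congr rfl fun j hj => by rw [Function.update_of_ne (Finset.ne_of_mem_erase hj)]]
  ring

/-- The excitation number of an atomic level: the level `0` is the excited one. -/
def level (c : Fin 2) : ℤ := if c = 0 then 1 else 0

/-- The total number of excitations of a number state. -/
def excitations (m : Fin M → ℕ) (b : Fin M → Fin 2) : ℤ := ∑ i, (m i : ℤ) + ∑ i, level (b i)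

theorem excitations_update_left (m : Fin M → ℕ) (b : Fin M → Fin 2) (i : Fin M) (n : ℕ) :
    excitations (Function.update m i n) b = excitations m b + (n - m i) := by
  rw [excitations, sum_update_apply (fun n : ℕ => (n : ℤ)), excitations]
  ring

theorem excitations_update_right (m : Fin M → ℕ) (b : Fin M → Fin 2) (i : Fin M) (c : Fin 2) :
    excitations m (Function.update b i c) = excitations m b + (level c - level (b i)) := by
  rw [excitations, sum_update_apply level, excitations]
  ring

/-- The span of the number states with `k` excitations. -/
def gradeSpace (M : ℕ) (k : ℤ) : Submodule ℂ (Sch M) :=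
  Submodule.span ℂ ((fun p : (Fin M → ℕ) × (Fin M → Fin 2) => numberState p.1 p.2) ''
    {p | excitations p.1 p.2 = k})

theorem numberState_mem_gradeSpace (m : Fin M → ℕ) (b : Fin M → Fin 2) :
    numberState m b ∈ gradeSpace M (excitations m b) :=
  Submodule.subset_span ⟨(m, b), rfl, rfl⟩

theorem gradeSpace_le (k : ℤ) : gradeSpace M k ≤ finiteExcitation M :=
  Submodule.span_mono (Set.image_subset_range _ _)

theorem map_mem_gradeSpace {A : Module.End ℂ (Sch M)} {k l : ℤ}
    (h : ∀ m b, excitations m b = k → A (numberState m b) ∈ gradeSpace M l) {f : Sch M}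
    (hf : f ∈ gradeSpace M k) : A f ∈ gradeSpace M l := by
  revert f
  change gradeSpace M k ≤ (gradeSpace M l).comap A
  refine Submodule.span_le.2 ?_
  rintro _ ⟨p, hp, rfl⟩
  exact h _ _ hp

/-- All summands are nonnegative, so each photon number is at most `k`. -/
theorem finite_setOf_excitations (k : ℤ) :
    {p : (Fin M → ℕ) × (Fin M → Fin 2) | excitations p.1 p.2 = k}.Finite := by
  have h1 : (Set.univ.pi fun _ : Fin M => Set.Iic k.toNat).Finite :=
    Set.Finite.pi fun _ => Set.finite_Iic _
  refine (h1.prod (Set.finite_univ (α := Fin M → Fin 2))).subset ?_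
  rintro ⟨m, b⟩ hp
  refine ⟨fun i _ => ?_, trivial⟩
  have h2 : (m i : ℤ) ≤ ∑ j, (m j : ℤ) :=
    Finset.single_le_sum (f := fun j => (m j : ℤ)) (fun j _ => by positivity) (Finset.mem_univ i)
  have h3 : 0 ≤ ∑ j, level (b j) := Finset.sum_nonneg fun j _ => by rw [level]; split_ifs <;> simp
  have h4 : ∑ j, (m j : ℤ) + ∑ j, level (b j) = k := hp
  change m i ≤ k.toNat
  omega

theorem finiteDimensional_gradeSpace (k : ℤ) : FiniteDimensional ℂ (gradeSpace M k) :=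
  FiniteDimensional.span_of_finite ℂ ((finite_setOf_excitations k).image _)

/-- The grading by `ℤ` lets lowering operators map grade `k` to `k - 1` without exception; the
negative grades it introduces are trivial. -/
theorem gradeSpace_eq_bot {k : ℤ} (hk : k < 0) : gradeSpace M k = ⊥ := by
  rw [gradeSpace, Submodule.span_eq_bot]
  rintro _ ⟨⟨m, b⟩, hp, rfl⟩
  have h3 : 0 ≤ ∑ j, level (b j) := Finset.sum_nonneg fun j _ => by rw [level]; split_ifs <;> simp
  have h5 : 0 ≤ ∑ j, (m j : ℤ) := Finset.sum_nonneg fun j _ => by positivity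
  have h4 : ∑ j, (m j : ℤ) + ∑ j, level (b j) = k := hp
  omega

theorem creation_mem_gradeSpace {k : ℤ} {f : Sch M} (hf : f ∈ gradeSpace M k) (i : Fin M) :
    creation i f ∈ gradeSpace M (k + 1) := by
  refine map_mem_gradeSpace (fun m b h => ?_) hf
  rw [creation_numberState]
  refine Submodule.smul_mem _ _ ?_
  convert numberState_mem_gradeSpace _ _ using 2
  rw [excitations_update_left, h]
  push_cast
  ring

theorem annihilation_mem_gradeSpace {k : ℤ} {f : Sch M} (hf : f ∈ gradeSpace M k) (i : Fin M) :
    annihilation i f ∈ gradeSpace M (k - 1) := by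
  refine map_mem_gradeSpace (fun m b h => ?_) hf
  rw [annihilation_numberState]
  rcases Nat.eq_zero_or_pos (m i) with h0 | h0
  · simp [h0]
  · refine Submodule.smul_mem _ _ ?_
    convert numberState_mem_gradeSpace _ _ using 2
    rw [excitations_update_left, h, Nat.cast_sub h0]
    push_cast
    ring

theorem atomOp_mem_gradeSpace {A : Matrix (Fin 2) (Fin 2) ℂ} {d : ℤ}
    (hA : ∀ c c', A c c' ≠ 0 → level c - level c' = d) {k : ℤ} {f : Sch M}
    (hf : f ∈ gradeSpace M k) (i : Fin M) : atomOp A i f ∈ gradeSpace M (k + d) := by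
  refine map_mem_gradeSpace (fun m b h => ?_) hf
  rw [atomOp_numberState]
  refine Submodule.sum_mem _ fun c _ => ?_
  by_cases h0 : A c (b i) = 0
  · simp [h0]
  · refine Submodule.smul_mem _ _ ?_
    convert numberState_mem_gradeSpace _ _ using 2
    rw [excitations_update_right, h, hA _ _ h0]

theorem pauliPlus_eq : pauliPlus = !![0, 1; 0, 0] := by
  ext i j
  fin_cases i <;> fin_cases j <;> simp [pauliPlus, pauliX, pauliY]; norm_num

theorem pauliMinus_eq : pauliMinus = !![0, 0; 1, 0] := by
  ext i j
  fin_cases i <;> fin_cases j <;> simp [pauliMinus, pauliX, pauliY]; norm_num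

theorem pauliPlus_conjTranspose : pauliPlus.conjTranspose = pauliMinus := by
  rw [pauliPlus_eq, pauliMinus_eq]
  ext i j
  fin_cases i <;> fin_cases j <;> simp

theorem pauliMinus_conjTranspose : pauliMinus.conjTranspose = pauliPlus := by
  rw [← pauliPlus_conjTranspose, Matrix.conjTranspose_conjTranspose]

theorem pauliZ_conjTranspose : pauliZ.conjTranspose = pauliZ := by
  ext i j
  fin_cases i <;> fin_cases j <;> simp [pauliZ]

theorem pauliX_conjTranspose : pauliX.conjTranspose = pauliX := by
  ext i j
  fin_cases i <;> fin_cases j <;> simp [pauliX]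

theorem pauliZ_mem_gradeSpace {k : ℤ} {f : Sch M} (hf : f ∈ gradeSpace M k) (i : Fin M) :
    atomOp pauliZ i f ∈ gradeSpace M k := by
  have := atomOp_mem_gradeSpace (A := pauliZ) (d := 0) (fun c c' h => by
    fin_cases c <;> fin_cases c' <;> simp_all [pauliZ, level]) hf i
  rwa [add_zero] at this

theorem pauliPlus_mem_gradeSpace {k : ℤ} {f : Sch M} (hf : f ∈ gradeSpace M k) (i : Fin M) :
    atomOp pauliPlus i f ∈ gradeSpace M (k + 1) :=
  atomOp_mem_gradeSpace (fun c c' h => by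
    fin_cases c <;> fin_cases c' <;> simp_all [pauliPlus_eq, level]) hf i

theorem pauliMinus_mem_gradeSpace {k : ℤ} {f : Sch M} (hf : f ∈ gradeSpace M k) (i : Fin M) :
    atomOp pauliMinus i f ∈ gradeSpace M (k - 1) :=
  atomOp_mem_gradeSpace (d := -1) (fun c c' h => by
    fin_cases c <;> fin_cases c' <;> simp_all [pauliMinus_eq, level]) hf i

/-- In the coupling `a* σ^- + a σ^+` every photon created or lost is paid for by an atomic
transition. -/
theorem drift_mem_gradeSpace (ωP ωA ωI : Fin M → ℝ) {k : ℤ} {f : Sch M}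
    (hf : f ∈ gradeSpace M k) : drift ωP ωA ωI f ∈ gradeSpace M k := by
  rw [drift, LinearMap.sum_apply]
  refine Submodule.sum_mem _ fun i _ => ?_
  have h1 := creation_mem_gradeSpace (annihilation_mem_gradeSpace hf i) i
  have h2 := creation_mem_gradeSpace (pauliMinus_mem_gradeSpace hf i) i
  have h3 := annihilation_mem_gradeSpace (pauliPlus_mem_gradeSpace hf i) i
  rw [sub_add_cancel] at h1 h2
  rw [add_sub_cancel_right] at h3
  exact add_mem (add_mem (Submodule.smul_mem _ _ h1)
    (Submodule.smul_mem _ _ (pauliZ_mem_gradeSpace hf i)))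
    (Submodule.smul_mem _ _ (add_mem h2 h3))

theorem hopping_mem_gradeSpace (I : Finset (Fin M × Fin M)) {k : ℤ} {f : Sch M}
    (hf : f ∈ gradeSpace M k) : hopping I f ∈ gradeSpace M k := by
  rw [hopping, LinearMap.sum_apply]
  refine Submodule.sum_mem _ fun p _ => ?_
  have h1 := creation_mem_gradeSpace (annihilation_mem_gradeSpace hf p.2) p.1
  have h2 := annihilation_mem_gradeSpace (creation_mem_gradeSpace hf p.2) p.1
  rw [sub_add_cancel] at h1
  rw [add_sub_cancel_right] at h2
  exact add_mem h1 h2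

/-- The projection of an atom to its excited level. -/
def excitedProj : Matrix (Fin 2) (Fin 2) ℂ := !![1, 0; 0, 0]

/-- The operator of the total number of excitations. -/
def excitationOp (M : ℕ) : Module.End ℂ (Sch M) :=
  ∑ i, (creation i * annihilation i + atomOp excitedProj i)

theorem creation_annihilation_numberState (m : Fin M → ℕ) (b : Fin M → Fin 2) (i : Fin M) :
    creation i (annihilation i (numberState m b)) = (m i : ℂ) • numberState m b := by
  rw [annihilation_numberState, map_smul, creation_numberState, smul_smul, Function.update_self,
    Function.update_idem]
  rcases Nat.eq_zero_or_pos (m i) with h0 | h0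
  · simp [h0]
  · rw [Nat.sub_add_cancel h0, Function.update_eq_self]
    congr 1
    have h1 : ((m i - 1 : ℕ) : ℝ) + 1 = m i := by
      rw [Nat.cast_sub h0]; push_cast; ring
    rw [h1, ← Complex.ofReal_mul, Real.mul_self_sqrt (by positivity), Complex.ofReal_natCast]

theorem excitedProj_numberState (m : Fin M → ℕ) (b : Fin M → Fin 2) (i : Fin M) :
    atomOp excitedProj i (numberState m b) = (level (b i) : ℂ) • numberState m b := by
  rw [atomOp_numberState, Fin.sum_univ_two]
  rcases Fin.exists_fin_two.1 ⟨b i, rfl⟩ with h | h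
  · have h2 : Function.update b i 0 = b := by rw [← h, Function.update_eq_self]
    rw [h, h2]
    simp [excitedProj, level]
  · have h2 : Function.update b i 1 = b := by rw [← h, Function.update_eq_self]
    rw [h, h2]
    simp [excitedProj, level]

theorem excitationOp_apply {k : ℤ} {f : Sch M} (hf : f ∈ gradeSpace M k) :
    excitationOp M f = (k : ℂ) • f := by
  induction hf using Submodule.span_induction with
  | mem x hx =>
    obtain ⟨⟨m, b⟩, hp, rfl⟩ := hx
    have hp' : excitations m b = k := hp
    rw [excitationOp, LinearMap.sum_apply]
    simp only [LinearMap.add_apply, Module.End.mul_apply, creation_annihilation_numberState,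
      excitedProj_numberState, ← add_smul, ← Finset.sum_smul]
    rw [← hp', excitations, Finset.sum_add_distrib]
    push_cast
    rfl
  | zero => simp
  | add x y _ _ hx hy => rw [map_add, hx, hy, smul_add]
  | smul c x _ hx => rw [map_smul, hx, smul_comm]

theorem excitedProj_conjTranspose : excitedProj.conjTranspose = excitedProj := by
  ext i j
  fin_cases i <;> fin_cases j <;> simp [excitedProj]

theorem inner_incl_excitationOp (f g : Sch M) :
    inner ℂ (incl M (excitationOp M f)) (incl M g) =
      (inner ℂ (incl M f) (incl M (excitationOp M g)) : ℂ) := by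
  simp only [excitationOp, LinearMap.sum_apply, map_sum, sum_inner, inner_sum]
  refine Finset.sum_congr rfl fun i _ => ?_
  simp only [LinearMap.add_apply, Module.End.mul_apply, map_add, inner_add_left, inner_add_right]
  rw [inner_incl_creation, inner_incl_annihilation, inner_incl_atomOp, excitedProj_conjTranspose]

/-- Different grades are eigenspaces of the symmetric operator `excitationOp` for different
eigenvalues, so no Hermite integral has to be computed. -/
theorem inner_gradeSpace_eq_zero {j k : ℤ} (hjk : j ≠ k) {f g : Sch M} (hf : f ∈ gradeSpace M j)
    (hg : g ∈ gradeSpace M k) : inner ℂ (incl M f) (incl M g) = (0 : ℂ) := by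
  have h := inner_incl_excitationOp f g
  rw [excitationOp_apply hf, excitationOp_apply hg, map_smul, map_smul, inner_smul_left,
    inner_smul_right, map_intCast, ← sub_eq_zero, ← sub_mul, mul_eq_zero] at h
  refine h.resolve_left ?_
  rw [sub_eq_zero]
  exact_mod_cast hjk

end Grading

/-! ### Symmetry of the Hamiltonians, dense domain and block eigenbases. -/

section Symmetry

variable {M : ℕ}

/-- `A` is symmetric on the finite excitation subspace. -/
def IsSymmOnFinite (A : Module.End ℂ (Sch M)) : Prop :=
  ∀ f ∈ finiteExcitation M, ∀ g ∈ finiteExcitation M,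
    inner ℂ (incl M (A f)) (incl M g) = (inner ℂ (incl M f) (incl M (A g)) : ℂ)

theorem IsSymmOnFinite.add {A B : Module.End ℂ (Sch M)} (hA : IsSymmOnFinite A)
    (hB : IsSymmOnFinite B) : IsSymmOnFinite (A + B) := fun f hf g hg => by
  simp only [LinearMap.add_apply, map_add, inner_add_left, inner_add_right, hA f hf g hg,
    hB f hf g hg]

theorem IsSymmOnFinite.smul {A : Module.End ℂ (Sch M)} (hA : IsSymmOnFinite A) (c : ℝ) :
    IsSymmOnFinite ((c : ℂ) • A) := fun f hf g hg => by
  simp only [LinearMap.smul_apply, map_smul, inner_smul_left, inner_smul_right, hA f hf g hg,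
    Complex.conj_ofReal]

theorem isSymmOnFinite_sum {κ : Type*} (s : Finset κ) {A : κ → Module.End ℂ (Sch M)}
    (hA : ∀ i ∈ s, IsSymmOnFinite (A i)) : IsSymmOnFinite (∑ i ∈ s, A i) := fun f hf g hg => by
  simp only [LinearMap.sum_apply, map_sum, sum_inner, inner_sum]
  exact Finset.sum_congr rfl fun i hi => hA i hi f hf g hg

theorem isSymmOnFinite_one : IsSymmOnFinite (1 : Module.End ℂ (Sch M)) := fun _ _ _ _ => rfl

theorem isSymmOnFinite_atomOp {A : Matrix (Fin 2) (Fin 2) ℂ} (hA : A.conjTranspose = A)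
    (i : Fin M) : IsSymmOnFinite (atomOp A i) := fun f _ g _ => by
  rw [inner_incl_atomOp, hA]

theorem eq_on_finiteExcitation {A B : Module.End ℂ (Sch M)}
    (h : ∀ m b, A (numberState m b) = B (numberState m b)) {f : Sch M}
    (hf : f ∈ finiteExcitation M) : A f = B f := by
  refine LinearMap.eqOn_span ?_ hf
  rintro _ ⟨p, rfl⟩
  exact h _ _

theorem annihilation_atomOp (A : Matrix (Fin 2) (Fin 2) ℂ) (i j : Fin M) {f : Sch M}
    (hf : f ∈ finiteExcitation M) :
    annihilation i (atomOp A j f) = atomOp A j (annihilation i f) :=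
  eq_on_finiteExcitation (A := annihilation i * atomOp A j) (B := atomOp A j * annihilation i)
    (fun m b => by
      simp only [Module.End.mul_apply, atomOp_numberState, annihilation_numberState, map_sum,
        map_smul, Finset.smul_sum]
      exact Finset.sum_congr rfl fun c _ => smul_comm _ _ _) hf

theorem creation_atomOp (A : Matrix (Fin 2) (Fin 2) ℂ) (i j : Fin M) {f : Sch M}
    (hf : f ∈ finiteExcitation M) :
    creation i (atomOp A j f) = atomOp A j (creation i f) :=
  eq_on_finiteExcitation (A := creation i * atomOp A j) (B := atomOp A j * creation i)
    (fun m b => by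
      simp only [Module.End.mul_apply, atomOp_numberState, creation_numberState, map_sum,
        map_smul, Finset.smul_sum]
      exact Finset.sum_congr rfl fun c _ => smul_comm _ _ _) hf

theorem creation_annihilation_comm {i j : Fin M} (hij : i ≠ j) {f : Sch M}
    (hf : f ∈ finiteExcitation M) :
    creation i (annihilation j f) = annihilation j (creation i f) :=
  eq_on_finiteExcitation (A := creation i * annihilation j) (B := annihilation j * creation i)
    (fun m b => by
      simp only [Module.End.mul_apply, annihilation_numberState, creation_numberState,
        map_smul, Function.update_of_ne hij, Function.update_of_ne hij.symm]
      rw [smul_comm, Function.update_comm hij]) hf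

theorem isSymmOnFinite_drift (ωP ωA ωI : Fin M → ℝ) : IsSymmOnFinite (drift ωP ωA ωI) := by
  refine isSymmOnFinite_sum _ fun i _ => IsSymmOnFinite.add (IsSymmOnFinite.add
    (IsSymmOnFinite.smul (fun f _ g _ => ?_) _)
    ((isSymmOnFinite_atomOp pauliZ_conjTranspose i).smul _))
    (IsSymmOnFinite.smul (fun f hf g hg => ?_) _)
  · rw [Module.End.mul_apply, inner_incl_creation, inner_incl_annihilation, Module.End.mul_apply]
  · simp only [LinearMap.add_apply, Module.End.mul_apply, map_add, inner_add_left,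
      inner_add_right]
    rw [inner_incl_creation, inner_incl_atomOp, inner_incl_annihilation, inner_incl_atomOp,
      pauliMinus_conjTranspose, pauliPlus_conjTranspose, annihilation_atomOp _ _ _ hg,
      creation_atomOp _ _ _ hg, add_comm]

/-- Ladder operators at distinct sites commute, so the two terms of each edge are formal adjoints of
one another. -/
theorem isSymmOnFinite_hopping {I : Finset (Fin M × Fin M)} (hlt : ∀ p ∈ I, p.1 < p.2) :
    IsSymmOnFinite (hopping I) := by
  refine isSymmOnFinite_sum _ fun p hp f hf g hg => ?_
  have hne := (hlt p hp).ne
  simp only [LinearMap.add_apply, Module.End.mul_apply, map_add, inner_add_left, inner_add_right]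
  rw [inner_incl_creation, inner_incl_annihilation, inner_incl_annihilation, inner_incl_creation,
    creation_annihilation_comm hne.symm hg, ← creation_annihilation_comm hne hg, add_comm]

theorem mem_graph_onFinite {A : Module.End ℂ (Sch M)} {p : Hil M × Hil M} :
    p ∈ (onFinite A).graph ↔ ∃ f ∈ finiteExcitation M, p = (incl M f, incl M (A f)) := by
  obtain ⟨ψ, χ⟩ := p
  rw [← exists_mem_domain_iff]
  constructor
  · rintro ⟨h, hh⟩
    obtain ⟨f, hf, rfl⟩ := h
    refine ⟨f, hf, ?_⟩
    rw [← hh, ← onFinite_apply A f hf]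
  · rintro ⟨f, hf, h⟩
    obtain ⟨rfl, rfl⟩ := Prod.mk.inj h
    exact ⟨Submodule.mem_map_of_mem hf, onFinite_apply A f hf⟩

theorem isSymmRel_onFinite {A : Module.End ℂ (Sch M)} (hA : IsSymmOnFinite A) :
    IsSymmRel (onFinite A).graph := by
  intro p hp q hq
  obtain ⟨f, hf, rfl⟩ := mem_graph_onFinite.1 hp
  obtain ⟨g, hg, rfl⟩ := mem_graph_onFinite.1 hq
  exact hA f hf g hg

theorem dense_domain_onFinite (A : Module.End ℂ (Sch M)) :
    Dense ((onFinite A).domain : Set (Hil M)) := by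
  rw [Submodule.dense_iff_topologicalClosure_eq_top, Submodule.topologicalClosure_eq_top_iff,
    Submodule.eq_bot_iff]
  intro ψ hψ
  refine eq_zero_of_inner_numberState fun m b => ?_
  exact (Submodule.mem_orthogonal _ _).1 hψ _
    (Submodule.mem_map_of_mem (Submodule.subset_span ⟨(m, b), rfl⟩))

/-- The image of `gradeSpace` in the Hilbert space. -/
def gradeHil (M : ℕ) (k : ℤ) : Submodule ℂ (Hil M) := (gradeSpace M k).map (incl M)

/-- The eigenvectors lie in the finite excitation subspace itself, not only in the domain of the
closure. -/
theorem exists_eigenbasis_onFinite {A : Module.End ℂ (Sch M)} (hA : IsSymmOnFinite A)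
    (hA' : ∀ k, ∀ f ∈ gradeSpace M k, A f ∈ gradeSpace M k) :
    ∃ (e : HilbertBasis (Σ k, Fin (Module.finrank ℂ (gradeHil M k))) ℂ (Hil M))
      (ev : (Σ k, Fin (Module.finrank ℂ (gradeHil M k))) → ℝ),
      ∀ n, e n ∈ gradeHil M n.1 ∧ (e n, (ev n : ℂ) • e n) ∈ (onFinite A).graph := by
  refine exists_eigenbasis_of_blocks (isSymmRel_onFinite hA) (gradeHil M) (fun k => ?_) ?_ ?_ ?_
  · have := finiteDimensional_gradeSpace (M := M) k
    exact inferInstanceAs (FiniteDimensional ℂ ((gradeSpace M k).map (incl M)))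
  · rintro j k hjk _ ⟨f, hf, rfl⟩ _ ⟨g, hg, rfl⟩
    exact inner_gradeSpace_eq_zero hjk hf hg
  · rw [Submodule.eq_bot_iff]
    intro ψ hψ
    refine eq_zero_of_inner_numberState fun m b => ?_
    exact (Submodule.mem_orthogonal _ _).1 hψ _
      (Submodule.mem_iSup_of_mem _ (Submodule.mem_map_of_mem (numberState_mem_gradeSpace m b)))
  · rintro k _ ⟨f, hf, rfl⟩
    exact ⟨incl M (A f), Submodule.mem_map_of_mem (hA' k f hf),
      mem_graph_onFinite.2 ⟨f, gradeSpace_le k hf, rfl⟩⟩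

/-- Annihilation lowers the state to the vacuum with nonzero factors, and the vacuum is a nonzero
Gaussian. -/
theorem numberState_ne_zero (b : Fin M → Fin 2) (i : Fin M) (n : ℕ) :
    numberState (Function.update (0 : Fin M → ℕ) i n) b ≠ 0 := by
  induction n with
  | zero =>
    intro h
    have h1 := numberState_zero_apply b (0 : Conf M)
    rw [show (0 : Fin M → ℕ) = Function.update (0 : Fin M → ℕ) i 0 by simp, h, eq_comm] at h1
    have h3 : 0 < gaussian M 0 := Real.exp_pos _
    have := Real.pi_pos
    have h4 : (Real.sqrt (Real.sqrt Real.pi))⁻¹ ^ M * gaussian M 0 ≠ 0 := by positivity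
    rcases smul_eq_zero.1 h1 with h5 | h5
    · exact h4 (Complex.ofReal_eq_zero.1 h5)
    · simpa using congrArg (fun v : Atoms M => v b) h5
  | succ n ih =>
    intro h
    have h1 := annihilation_numberState (Function.update (0 : Fin M → ℕ) i (n + 1)) b i
    rw [h, map_zero, Function.update_self, Nat.add_sub_cancel, Function.update_idem, eq_comm,
      smul_eq_zero, Complex.ofReal_eq_zero] at h1
    refine h1.elim (fun h2 => ?_) ih
    have : (0 : ℝ) < Real.sqrt ((n + 1 : ℕ) : ℝ) := Real.sqrt_pos.2 (by positivity)
    exact this.ne' h2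

theorem not_finiteDimensional_hil (i : Fin M) : ¬ FiniteDimensional ℂ (Hil M) := by
  intro hfin
  let v : ℕ → Hil M := fun n => incl M (numberState (Function.update (0 : Fin M → ℕ) i n) 0)
  have hv : LinearIndependent ℂ v := by
    refine linearIndependent_of_ne_zero_of_inner_eq_zero (fun n => ?_) fun a c hac => ?_
    · exact (map_ne_zero_iff _ (incl_injective M)).2 (numberState_ne_zero _ i n)
    · refine inner_gradeSpace_eq_zero ?_ (numberState_mem_gradeSpace _ _)
        (numberState_mem_gradeSpace _ _)
      rw [excitations_update_left, excitations_update_left]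
      intro h
      exact hac (by simpa using h)
  have := hv.finite
  exact not_finite ℕ

end Symmetry

end JCH

namespace JCH

open MeasureTheory Filter Topology

/-! ### Growth of the drift, the `σ^x` perturbation and the diagonal form of all Hamiltonians. -/

section DriftBound

variable {M : ℕ}

theorem norm_incl_atomOp_le (A : Matrix (Fin 2) (Fin 2) ℂ) (i : Fin M) (f : Sch M) :
    ‖incl M (atomOp A i f)‖ ≤ ‖atomCLM A i‖ * ‖incl M f‖ := by
  rw [incl_atomOp]
  exact (atomCLM A i).le_opNorm _

theorem neg_norm_mul_norm_le_re_inner {E : Type*} [NormedAddCommGroup E] [InnerProductSpace ℂ E]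
    (x y : E) : -(‖x‖ * ‖y‖) ≤ (inner ℂ x y : ℂ).re :=
  neg_le_of_abs_le ((Complex.abs_re_le_norm _).trans (norm_inner_le_norm x y))

/-- The photon term equals `p ‖a f‖²`. The atomic term is bounded, and the coupling is at most
linear in `‖a f‖`, so half of the photon term absorbs it. -/
theorem re_inner_drift_term_ge {p a c : ℝ} (hp : 0 < p) (ha : 0 < a) (hc : 0 < c) (i : Fin M) :
    ∃ C : ℝ, ∀ f ∈ finiteExcitation M,
      p / 2 * ‖incl M (annihilation i f)‖ ^ 2 - C * ‖incl M f‖ ^ 2 ≤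
      (inner ℂ (incl M f) (incl M (((p : ℂ) • (creation i * annihilation i) +
        (a : ℂ) • atomOp pauliZ i + (c : ℂ) • (creation i * atomOp pauliMinus i +
          annihilation i * atomOp pauliPlus i)) f)) : ℂ).re := by
  set S := ‖atomCLM pauliMinus i‖
  set Z := ‖atomCLM pauliZ i‖
  refine ⟨a * Z + 2 * (c * S) ^ 2 / p, fun f hf => ?_⟩
  set N := ‖incl M (annihilation i f)‖ with hN
  set F := ‖incl M f‖ with hF
  have h1 : (inner ℂ (incl M f) (incl M (creation i (annihilation i f))) : ℂ).re = N ^ 2 := by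
    rw [← inner_incl_annihilation, inner_self_eq_norm_sq_to_K, ← hN]
    norm_cast
  have h2 : -(Z * F ^ 2) ≤ (inner ℂ (incl M f) (incl M (atomOp pauliZ i f)) : ℂ).re := by
    refine le_trans ?_ (neg_norm_mul_norm_le_re_inner _ _)
    have := mul_le_mul_of_nonneg_left (norm_incl_atomOp_le pauliZ i f) (norm_nonneg (incl M f))
    linarith
  have hS : N * ‖incl M (atomOp pauliMinus i f)‖ ≤ N * (S * F) :=
    mul_le_mul_of_nonneg_left (norm_incl_atomOp_le pauliMinus i f) (norm_nonneg _)
  have h3 : -(N * (S * F)) ≤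
      (inner ℂ (incl M f) (incl M (creation i (atomOp pauliMinus i f))) : ℂ).re := by
    rw [← inner_incl_annihilation]
    exact le_trans (neg_le_neg hS) (neg_norm_mul_norm_le_re_inner _ _)
  -- Moving `σ^+` to the left gives `⟨σ^- f, a f⟩`, so both coupling terms obey the same bound.
  have h4 : -(N * (S * F)) ≤
      (inner ℂ (incl M f) (incl M (annihilation i (atomOp pauliPlus i f))) : ℂ).re := by
    rw [annihilation_atomOp _ _ _ hf, ← pauliMinus_conjTranspose, ← inner_incl_atomOp]
    refine le_trans (neg_le_neg hS) ?_
    rw [mul_comm]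
    exact neg_norm_mul_norm_le_re_inner _ _
  simp only [LinearMap.add_apply, LinearMap.smul_apply, Module.End.mul_apply, map_add, map_smul,
    inner_add_right, inner_smul_right, Complex.add_re, Complex.re_ofReal_mul, h1]
  -- The square whose expansion trades the cross term `2cSNF` for `p/2 N²` and `2(cS)²/p F²`; it
  -- fixes the constant above.
  have h5 : 0 ≤ p / 2 * (N - 2 * (c * S) / p * F) ^ 2 := by positivity
  have h6 : p / 2 * (N - 2 * (c * S) / p * F) ^ 2 =
      p / 2 * N ^ 2 - 2 * (c * (N * (S * F))) + 2 * (c * S) ^ 2 / p * F ^ 2 := by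
    field_simp
    ring
  have h7 := mul_le_mul_of_nonneg_left h2 ha.le
  have h8 := mul_le_mul_of_nonneg_left (add_le_add h3 h4) hc.le
  linarith

/-- The expectation of the excitation number in grade `k` is `k ‖f‖²`, and the atoms contribute only
a bounded amount to it. -/
theorem sum_norm_annihilation_sq {k : ℤ} {f : Sch M} (hf : f ∈ gradeSpace M k) :
    (k - ∑ i, ‖atomCLM (M := M) excitedProj i‖) * ‖incl M f‖ ^ 2 ≤
      ∑ i, ‖incl M (annihilation i f)‖ ^ 2 := by
  have h1 : (inner ℂ (incl M f) (incl M (excitationOp M f)) : ℂ).re = k * ‖incl M f‖ ^ 2 := by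
    rw [excitationOp_apply hf, map_smul, inner_smul_right, inner_self_eq_norm_sq_to_K,
      ← Complex.ofReal_intCast, Complex.re_ofReal_mul]
    norm_cast
  have h2 : (inner ℂ (incl M f) (incl M (excitationOp M f)) : ℂ).re =
      ∑ i, (‖incl M (annihilation i f)‖ ^ 2 +
        (inner ℂ (incl M f) (incl M (atomOp excitedProj i f)) : ℂ).re) := by
    simp only [excitationOp, LinearMap.sum_apply, map_sum, inner_sum, Complex.re_sum,
      LinearMap.add_apply, Module.End.mul_apply, map_add, inner_add_right, Complex.add_re]
    refine Finset.sum_congr rfl fun i _ => ?_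
    rw [← inner_incl_annihilation, inner_self_eq_norm_sq_to_K]
    norm_cast
  have h3 : ∑ i, (inner ℂ (incl M f) (incl M (atomOp excitedProj i f)) : ℂ).re ≤
      ∑ i, ‖atomCLM (M := M) excitedProj i‖ * ‖incl M f‖ ^ 2 := by
    refine Finset.sum_le_sum fun i _ => ?_
    refine (Complex.re_le_norm _).trans ((norm_inner_le_norm _ _).trans ?_)
    have := mul_le_mul_of_nonneg_left (norm_incl_atomOp_le excitedProj i f)
      (norm_nonneg (incl M f))
    linarith
  rw [Finset.sum_add_distrib, h1] at h2
  rw [← Finset.sum_mul] at h3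
  linarith

theorem exists_re_inner_drift_ge [Nonempty (Fin M)] {ωP ωA ωI : Fin M → ℝ} (hP : ∀ i, 0 < ωP i)
    (hA : ∀ i, 0 < ωA i) (hI : ∀ i, 0 < ωI i) :
    ∃ c > 0, ∃ C : ℝ, ∀ k, ∀ f ∈ gradeSpace M k, (c * k - C) * ‖incl M f‖ ^ 2 ≤
      (inner ℂ (incl M f) (incl M (drift ωP ωA ωI f)) : ℂ).re := by
  obtain ⟨i₀, hi₀⟩ := Finite.exists_min ωP
  choose C hC using fun i => re_inner_drift_term_ge (M := M) (hP i) (hA i) (hI i) i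
  have hc : 0 < ωP i₀ / 2 := half_pos (hP i₀)
  refine ⟨ωP i₀ / 2, hc,
    ωP i₀ / 2 * ∑ i, ‖atomCLM (M := M) excitedProj i‖ + ∑ i, C i, fun k f hf => ?_⟩
  have h1 : ∑ i, (ωP i₀ / 2 * ‖incl M (annihilation i f)‖ ^ 2 - C i * ‖incl M f‖ ^ 2) ≤
      (inner ℂ (incl M f) (incl M (drift ωP ωA ωI f)) : ℂ).re := by
    rw [drift, LinearMap.sum_apply, map_sum, inner_sum, Complex.re_sum]
    refine Finset.sum_le_sum fun i _ => le_trans ?_ (hC i f (gradeSpace_le k hf))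
    have := hi₀ i
    gcongr
  rw [Finset.sum_sub_distrib, ← Finset.mul_sum, ← Finset.sum_mul] at h1
  have h2 := mul_le_mul_of_nonneg_left (sum_norm_annihilation_sq hf) hc.le
  refine le_trans ?_ h1
  linarith

/-- An eigenvalue in grade `k` is at least `c k - C`, the grades present are nonnegative, and each
holds finitely many basis vectors. -/
theorem tendsto_eigenvalues_drift [Nonempty (Fin M)] {ωP ωA ωI : Fin M → ℝ} (hP : ∀ i, 0 < ωP i)
    (hA : ∀ i, 0 < ωA i) (hI : ∀ i, 0 < ωI i)
    (e : HilbertBasis (Σ k, Fin (Module.finrank ℂ (gradeHil M k))) ℂ (Hil M))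
    (ev : (Σ k, Fin (Module.finrank ℂ (gradeHil M k))) → ℝ)
    (h : ∀ n, e n ∈ gradeHil M n.1 ∧
      (e n, (ev n : ℂ) • e n) ∈ (onFinite (drift ωP ωA ωI)).graph) :
    Tendsto ev cofinite atTop := by
  obtain ⟨c, hc, C, hC⟩ := exists_re_inner_drift_ge hP hA hI
  have hev : ∀ n, c * n.1 - C ≤ ev n := by
    intro n
    obtain ⟨⟨f, hf, hfe⟩, hn⟩ := h n
    obtain ⟨g, _, hg⟩ := mem_graph_onFinite.1 hn
    obtain ⟨h1, h2⟩ := Prod.mk.inj hg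
    have hfg : f = g := incl_injective M (hfe.trans h1)
    have h3 := hC n.1 f hf
    rw [hfg, ← h2, ← h1, inner_smul_right, inner_hilbertBasis_self, e.orthonormal.1 n, mul_one,
      Complex.ofReal_re, one_pow, mul_one] at h3
    exact h3
  have hpos : ∀ n : (Σ k, Fin (Module.finrank ℂ (gradeHil M k))), 0 ≤ n.1 := by
    intro n
    by_contra hn
    have h1 := (h n).1
    rw [gradeHil, gradeSpace_eq_bot (not_le.1 hn), Submodule.map_bot, Submodule.mem_bot] at h1
    have h2 := e.orthonormal.1 n
    rw [h1, norm_zero] at h2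
    exact zero_ne_one h2
  rw [tendsto_atTop]
  intro b
  have hfin : {n | ¬ b ≤ ev n}.Finite := by
    refine Set.Finite.subset ((Finset.Icc (0 : ℤ) ⌈(b + C) / c⌉).sigma
      fun k => (Finset.univ : Finset (Fin (Module.finrank ℂ (gradeHil M k))))).finite_toSet ?_
    intro n hn
    rw [Set.mem_ofPred_eq, not_le] at hn
    simp only [Finset.coe_sigma, Set.mem_sigma_iff, Finset.coe_univ, Set.mem_univ, and_true,
      Finset.coe_Icc, Set.mem_Icc]
    refine ⟨hpos n, ?_⟩
    have h1 : (n.1 : ℝ) ≤ (b + C) / c := by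
      rw [le_div_iff₀ hc]
      have := hev n
      linarith
    exact_mod_cast h1.trans (Int.le_ceil _)
  exact hfin

/-- Adding a bounded operator is a continuous shear of graphs, so it commutes with passing to
closures. -/
theorem add_atomOp_mem_topologicalClosure {A : Module.End ℂ (Sch M)}
    (S : Matrix (Fin 2) (Fin 2) ℂ) (i : Fin M) {p : Hil M × Hil M}
    (hp : p ∈ (onFinite A).graph.topologicalClosure) :
    (p.1, p.2 + atomCLM S i p.1) ∈ (onFinite (A + atomOp S i)).graph.topologicalClosure := by
  have hc : Continuous fun p : Hil M × Hil M => (p.1, p.2 + atomCLM S i p.1) := by fun_prop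
  refine map_mem_closure (s := (onFinite A).graph) (f := fun p : Hil M × Hil M =>
    (p.1, p.2 + atomCLM S i p.1)) hc hp ?_
  intro q hq
  obtain ⟨f, hf, rfl⟩ := mem_graph_onFinite.1 hq
  refine mem_graph_onFinite.2 ⟨f, hf, ?_⟩
  rw [LinearMap.add_apply, map_add, incl_atomOp]

theorem exists_resolvent_sigmaX [Nonempty (Fin M)] {ωP ωA ωI : Fin M → ℝ} (hP : ∀ i, 0 < ωP i)
    (hA : ∀ i, 0 < ωA i) (hI : ∀ i, 0 < ωI i) (i : Fin M) :
    ∃ (r : ℝ) (R : Hil M →L[ℂ] Hil M), IsCompactOperator R ∧ Function.Injective R ∧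
      ∀ u, (R u, (r : ℂ) • R u - u) ∈
        (onFinite (drift ωP ωA ωI + atomOp pauliX i)).graph.topologicalClosure := by
  obtain ⟨e, ev, h⟩ := exists_eigenbasis_onFinite (isSymmOnFinite_drift ωP ωA ωI)
    fun k f hf => drift_mem_gradeSpace ωP ωA ωI hf
  refine exists_compact_resolvent_of_perturbation e
    (tendsto_eigenvalues_drift hP hA hI e ev h) (atomCLM pauliX i) fun p hp => ?_
  exact add_atomOp_mem_topologicalClosure pauliX i
    (diagGraph_le_topologicalClosure e ev
      (fun n => Submodule.le_topologicalClosure _ (h n).2) hp)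

theorem isSymmOnFinite_sigmaX (ωP ωA ωI : Fin M → ℝ) (i : Fin M) :
    IsSymmOnFinite (drift ωP ωA ωI + atomOp pauliX i) :=
  (isSymmOnFinite_drift ωP ωA ωI).add (isSymmOnFinite_atomOp pauliX_conjTranspose i)

theorem separableSpace_hil : TopologicalSpace.SeparableSpace (Hil M) := by
  have : Fact ((2 : ENNReal) ≠ ⊤) := ⟨ENNReal.ofNat_ne_top⟩
  exact TopologicalSpace.SecondCountableTopology.to_separableSpace

theorem exists_closure_onFinite_eq_diagOp [Nonempty (Fin M)] {A : Module.End ℂ (Sch M)}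
    (hA : IsSymmOnFinite A) (hA' : ∀ k, ∀ f ∈ gradeSpace M k, A f ∈ gradeSpace M k) :
    ∃ (e : HilbertBasis ℕ ℂ (Hil M)) (ev : ℕ → ℝ), (onFinite A).closure = diagOp e ev := by
  have := separableSpace_hil (M := M)
  obtain ⟨e, ev, h⟩ := exists_eigenbasis_onFinite hA hA'
  exact exists_closure_eq_diagOp (not_finiteDimensional_hil (Classical.arbitrary (Fin M)))
    (isSymmRel_onFinite hA) e ev fun n => Submodule.le_topologicalClosure _ (h n).2

/-- All cases but `σ^x` preserve the grading and use blocks; `σ^x` mixes neighbouring grades and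
goes through its compact resolvent. -/
theorem hamiltonian_eq_diagOp [Nonempty (Fin M)] {ωP ωA ωI : Fin M → ℝ} (hP : ∀ i, 0 < ωP i)
    (hA : ∀ i, 0 < ωA i) (hI : ∀ i, 0 < ωI i) {I : Finset (Fin M × Fin M)}
    (hlt : ∀ p ∈ I, p.1 < p.2) (k : Option (Control M)) :
    ∃ (e : HilbertBasis ℕ ℂ (Hil M)) (ev : ℕ → ℝ),
      hamiltonian ωP ωA ωI I k = diagOp e ev := by
  have hd := isSymmOnFinite_drift ωP ωA ωI
  have := separableSpace_hil (M := M)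
  match k with
  | none =>
    exact exists_closure_onFinite_eq_diagOp hd fun k f hf => drift_mem_gradeSpace ωP ωA ωI hf
  | some (.sigmaZ i) =>
    exact exists_closure_onFinite_eq_diagOp
      (hd.add (isSymmOnFinite_atomOp pauliZ_conjTranspose i)) fun k f hf =>
      add_mem (drift_mem_gradeSpace ωP ωA ωI hf) (pauliZ_mem_gradeSpace hf i)
  | some .hop =>
    exact exists_closure_onFinite_eq_diagOp (hd.add (isSymmOnFinite_hopping hlt)) fun k f hf =>
      add_mem (drift_mem_gradeSpace ωP ωA ωI hf) (hopping_mem_gradeSpace I hf)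
  | some .one =>
    exact exists_closure_onFinite_eq_diagOp (hd.add isSymmOnFinite_one) fun k f hf =>
      add_mem (drift_mem_gradeSpace ωP ωA ωI hf) hf
  | some (.sigmaX i) =>
    have hs := isSymmRel_onFinite (isSymmOnFinite_sigmaX ωP ωA ωI i)
    obtain ⟨r, R, hRc, hRi, hR⟩ := exists_resolvent_sigmaX hP hA hI i
    obtain ⟨ι, e, ev, h⟩ := exists_eigenbasis_of_compact hs
      (isClosable_of_isSymmRel hs (dense_domain_onFinite _)) hRc hRi hR
    exact exists_closure_eq_diagOp (not_finiteDimensional_hil i) hs e ev h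

theorem hasCompactResolvent_sigmaX [Nonempty (Fin M)] {ωP ωA ωI : Fin M → ℝ} (hP : ∀ i, 0 < ωP i)
    (hA : ∀ i, 0 < ωA i) (hI : ∀ i, 0 < ωI i) (I : Finset (Fin M × Fin M)) (i : Fin M) :
    HasCompactResolvent (hamiltonian ωP ωA ωI I (some (.sigmaX i))) := by
  have hs := isSymmRel_onFinite (isSymmOnFinite_sigmaX ωP ωA ωI i)
  obtain ⟨r, R, hRc, _, hR⟩ := exists_resolvent_sigmaX hP hA hI i
  have hres := isResolvent_closure hs (isClosable_of_isSymmRel hs (dense_domain_onFinite _)) hR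
  exact ⟨⟨r, R, hres⟩, fun _ _ hS => isCompactOperator_of_isResolvent hres hS hRc⟩

end DriftBound

end JCH

end

theorem mainTheorem5 (M : ℕ) (hM : 2 ≤ M) (ωP ωA ωI : Fin M → ℝ)
    (hP : ∀ i, 0 < ωP i) (hA : ∀ i, 0 < ωA i) (hI : ∀ i, 0 < ωI i)
    (I : Finset (Fin M × Fin M)) (hlt : ∀ p ∈ I, p.1 < p.2)
    (hconn : (SimpleGraph.fromRel fun i j : Fin M => (i, j) ∈ I).Connected) :
    (∀ k : Option (JCH.Control M),
      IsSelfAdjoint (JCH.hamiltonian ωP ωA ωI I k) ∧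
      JCH.HasOrthonormalEigenbasis (JCH.hamiltonian ωP ωA ωI I k)) ∧
    (∀ i : Fin M, JCH.HasCompactResolvent (JCH.hamiltonian ωP ωA ωI I (some (.sigmaX i)))) ∧
    (∀ k : Option (JCH.Control M),
      (∃! U, JCH.IsExpGroup (JCH.hamiltonian ωP ωA ωI I k) U) ∧
      ∀ U, JCH.IsExpGroup (JCH.hamiltonian ωP ωA ωI I k) U → JCH.IsRecurrent U) := by
  have : Nonempty (Fin M) := ⟨⟨0, by omega⟩⟩
  refine ⟨fun k => ?_, JCH.hasCompactResolvent_sigmaX hP hA hI I, fun k => ?_⟩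
  · obtain ⟨e, ev, h⟩ := JCH.hamiltonian_eq_diagOp hP hA hI hlt k
    rw [h]
    exact ⟨JCH.isSelfAdjoint_diagOp e ev, JCH.hasOrthonormalEigenbasis_diagOp e ev⟩
  · obtain ⟨e, ev, h⟩ := JCH.hamiltonian_eq_diagOp hP hA hI hlt k
    rw [h]
    exact JCH.existsUnique_isExpGroup_diagOp e ev
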